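/- Let $n\ge 2$ and $0<\delta<1$. Write $\hat g(\xi)=\int_{\mathbb{R}^n}e^{-2\pi i x\cdot\xi}g(x)\,dx$ for the Fourier transform (extended to $L^2(\mathbb{R}^n)$ and to tempered distributions), and let $$\Sigma_\delta(\mathbb{R}^n)=\{f\in L^2(\mathbb{R}^n)\;:\;|x|^\delta f\in L^2(\mathbb{R}^n)\ \text{and}\ |\xi|^\delta\hat f\in L^2(\mathbb{R}^n)\}.$$ For $f\in\Sigma_\delta(\mathbb{R}^n)$ let $u$ be the solution of $\partial_t u=\frac{i}{2}\hbar\Delta u$, $\hbar=\frac1{2\pi}$, $u(\cdot,0)=f$, i.e. $\hat u(\xi,t)=e^{-\pi i t|\xi|^2}\hat f(\xi)$, and let $$h_\delta[f](t)=\int_{\mathbb{R}^n}|x|^{2\delta}|u(x,t)|^2\,dx .$$ Let $\zeta\in C_0^\infty(\mathbb{R})$ be an even, nonnegative function with support in $(-1,1)$ and $\zeta=1$ in a neighbourhood of $0$, and put $\zeta_\varepsilon(t)=\zeta(t/\varepsilon)$ for $\varepsilon>0$. Then there are real constants $A$ and $B$, depending only on $\zeta$, $n$ and $\delta$, such that for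 every $f\in\Sigma_\delta(\mathbb{R}^n)$ the function $h_\delta=h_\delta[f]$ is finite for all times and defines a tempered distribution on $\mathbb{R}$, and, as $\varepsilon\to0^+$: - if $\delta<\frac12$, then $$\langle\hat h_\delta,\zeta_\varepsilon\rangle=A\,\varepsilon^{-2\delta}\,\||\xi|^\delta\hat f\|_2^2+o(1);$$ - if $\delta=\frac12$, then $$\langle\hat h_\delta,\zeta_\varepsilon\rangle=A\,\varepsilon^{-1}\,\||\xi|^{1/2}\hat f\|_2^2+B\int_{|\xi|>\sqrt{2\varepsilon}}|\hat f(\xi)|^2\,\frac{d\xi}{|\xi|}+o(1)=A\,\varepsilon^{-1}\,\||\xi|^{1/2}\hat f\|_2^2+O(-\log\varepsilon);$$ - if $\delta>\frac12$, then $|\xi|^{-1/2}\hat f\in L^2(\mathbb{R}^n)$ and $$\langle\hat h_\delta,\zeta_\varepsilon\rangle=A\,\varepsilon^{-2\delta}\,\||\xi|^\delta\hat f\|_2^2+B\,\varepsilon^{\frac12-\delta}\,\||\xi|^{-1/2}\hat f\|_2^2+o(1).$$ -/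

import Mathlib

open MeasureTheory Filter Topology Asymptotics FourierTransform
open scoped SchwartzMap ContDiff

noncomputable section

/-- Euclidean space `ℝⁿ`. -/
abbrev Rn (n : ℕ) : Type := EuclideanSpace ℝ (Fin n)

/-- The Hilbert space `L²(ℝⁿ; ℂ)`. -/
abbrev L2Rn (n : ℕ) : Type := Lp (α := Rn n) ℂ 2 (volume : Measure (Rn n))

/-- The weighted function `x ↦ |x|^s g(x)`. -/
def powWeight {n : ℕ} (s : ℝ) (g : L2Rn n) : Rn n → ℂ :=
  fun x => ((‖x‖ ^ s : ℝ) : ℂ) * g x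

/-- The norm `‖ |x|^s g ‖_{L²(ℝⁿ)}`; it is only meaningful when `|x|^s g` lies in `L²`. -/
def weightedNorm {n : ℕ} (s : ℝ) (g : L2Rn n) : ℝ :=
  (eLpNorm (powWeight s g) 2 volume).toReal

/-- The space `Σ_δ(ℝⁿ)`: those `f ∈ L²` with `|x|^δ f ∈ L²` and `|ξ|^δ f̂ ∈ L²`. Here `𝓕` is the
`L²` Fourier transform, normalized with the kernel `e^{-2πi x·ξ}`. -/
def MemSigma {n : ℕ} (δ : ℝ) (f : L2Rn n) : Prop :=
  MemLp (powWeight δ f) 2 volume ∧ MemLp (powWeight δ (𝓕 f : L2Rn n)) 2 volume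

/-- The free Schrödinger symbol `e^{-π i t |ξ|²}`. -/
def schrodingerSymbol {n : ℕ} (t : ℝ) (ξ : Rn n) : ℂ :=
  Complex.exp (((-(Real.pi * t * ‖ξ‖ ^ 2) : ℝ) : ℂ) * Complex.I)

theorem memLp_schrodingerSymbol_mul {n : ℕ} (t : ℝ) (g : L2Rn n) :
    MemLp (fun ξ : Rn n => schrodingerSymbol t ξ * g ξ) 2 volume := by
  have hc : Continuous (schrodingerSymbol t : Rn n → ℂ) := by
    unfold schrodingerSymbol
    fun_prop
  refine (Lp.memLp g).of_le (hc.aestronglyMeasurable.mul (Lp.aestronglyMeasurable g)) ?_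
  refine Eventually.of_forall fun ξ => ?_
  simp only [norm_mul, schrodingerSymbol, Complex.norm_exp_ofReal_mul_I, one_mul, le_refl]

/-- The solution at time `t` of `∂ₜ u = (i/2) ħ Δ u`, `ħ = 1/(2π)`, `u(·, 0) = f ∈ L²`, that is
`u(t) = e^{i t ħ Δ / 2} f`: since `Δ` has the symbol `-4π²|ξ|²`, `û(ξ, t) = e^{-π i t |ξ|²} f̂(ξ)`. -/
def schrodingerFlow {n : ℕ} (f : L2Rn n) (t : ℝ) : L2Rn n :=
  𝓕⁻ ((memLp_schrodingerSymbol_mul t (𝓕 f : L2Rn n)).toLp : L2Rn n)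

/-- The density `|x|^{2δ} |u(x, t)|²`, where `u` is the solution with initial datum `f`. -/
def dispersionDensity {n : ℕ} (δ : ℝ) (f : L2Rn n) (t : ℝ) : Rn n → ℝ :=
  fun x => ‖x‖ ^ (2 * δ) * ‖schrodingerFlow f t x‖ ^ 2

/-- The functional `h_δ[f](t) = ∫ |x|^{2δ} |u(x, t)|² dx`. -/
def dispersion {n : ℕ} (δ : ℝ) (f : L2Rn n) (t : ℝ) : ℝ :=
  ∫ x, dispersionDensity δ f t x

/-- The tempered distribution `H` is given by integration against the function `h`. -/
def IsGivenBy (H : 𝓢'(ℝ, ℂ)) (h : ℝ → ℝ) : Prop :=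
  ∀ φ : 𝓢(ℝ, ℂ), Integrable (fun t => (h t : ℂ) * φ t) volume ∧
    H φ = ∫ t, (h t : ℂ) * φ t

theorem hasCompactSupport_dilate {ζ : ℝ → ℝ} (hc : HasCompactSupport ζ) {ε : ℝ} (hε : 0 < ε) :
    HasCompactSupport (fun t => ((ζ (t / ε) : ℝ) : ℂ)) := by
  have h := (hc.comp_homeomorph (Homeomorph.mulRight₀ ε⁻¹ (inv_ne_zero hε.ne'))).comp_left
    (g := fun x : ℝ => (x : ℂ)) Complex.ofReal_zero
  simpa [Function.comp_def, div_eq_mul_inv] using h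

theorem contDiff_dilate {ζ : ℝ → ℝ} (hs : ContDiff ℝ ∞ ζ) (ε : ℝ) :
    ContDiff ℝ ∞ (fun t => ((ζ (t / ε) : ℝ) : ℂ)) :=
  Complex.ofRealCLM.contDiff.comp (hs.comp (contDiff_id.div_const ε))

open Classical in
/-- The test function `ζ_ε(t) = ζ(t/ε)`, for `ε > 0`, as a Schwartz function (and `0` otherwise). -/
def dilate (ζ : ℝ → ℝ) (hs : ContDiff ℝ ∞ ζ) (hc : HasCompactSupport ζ) (ε : ℝ) : 𝓢(ℝ, ℂ) :=
  if hε : 0 < ε then (hasCompactSupport_dilate hc hε).toSchwartzMap (contDiff_dilate hs ε) else 0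

theorem dilate_apply (ζ : ℝ → ℝ) (hs : ContDiff ℝ ∞ ζ) (hc : HasCompactSupport ζ) {ε : ℝ}
    (hε : 0 < ε) (t : ℝ) : dilate ζ hs hc ε t = ((ζ (t / ε) : ℝ) : ℂ) := by
  simp [dilate, hε]

end

/-! On the Fourier side the weight |x|^{2δ} becomes a difference quotient. Since ∫ (1 - cos 2πx·z)
|z|^{-n-2δ} dz = κ|x|^{2δ}, Plancherel gives 2κ h_δ(t) = ∬ |û(η+z,t) - û(η,t)|² |z|^{-n-2δ} dη dz
(`gagliardoEnergy_fourier`, `dispersion_eq`).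

Put g = f̂ and θ = πt(|η+z|² - |η|²). Up to a unimodular factor the difference is e^{-iθ}g(η+z) -
g(η). Averaging its squared modulus over t and -t removes the sine term and leaves cos θ |g(η+z) -
g(η)|² + (1 - cos θ)(|g(η+z)|² + |g(η)|²). For fixed η the z-integral of (1 - cos θ)|z|^{-n-2δ}
equals κ|t|^{2δ}|η|^{2δ} plus a correction (`integrable_phase_kernel`). So the even part of h_δ is
|t|^{2δ}‖|ξ|^δ f̂‖², plus multiples of ∫ cos θ dM, with M the finite measure |g(η+z) -
g(η)|²|z|^{-n-2δ} dz dη, and of the correction integrated against |g|² (`dispersion_even_part`).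

As ζ is even, pairing with the Fourier transform of ζ_ε sees only this even part, at time τ/ε. The
first term scales exactly to A ε^{-2δ}‖|ξ|^δ f̂‖². By Fourier inversion the second becomes ∫
ζ((|η+z|² - |η|²)/(2ε)) dM, which tends to 0 because M does not charge |η+z| = |η|
(`tendsto_integral_cutoff`). The correction is O(|η|^{-2δ}) uniformly in t and O(|t|^{δ-1}|η|^{-2})
(`exists_abs_oscCorrection_le`); the fractional Hardy inequality makes |η|^{-2δ}|g|² integrable, so
dominated convergence sends this term to 0 as well (`tendsto_integral_oscCorrection`). The remainder
is thus o(1) for every δ, and B = 0 serves in all three regimes. -/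

noncomputable section

/-! ### The Gagliardo kernel and its Gaussian subordination -/

/-- The Gagliardo kernel `|z|^{-n-2δ}`. -/
def gagliardoKernel (n : ℕ) (δ : ℝ) (z : Rn n) : ℝ := ‖z‖ ^ (-(n + 2 * δ) : ℝ)

theorem gagliardoKernel_nonneg {n : ℕ} (δ : ℝ) (z : Rn n) : 0 ≤ gagliardoKernel n δ z :=
  Real.rpow_nonneg (norm_nonneg _) _

theorem gagliardoKernel_neg {n : ℕ} (δ : ℝ) (z : Rn n) :
    gagliardoKernel n δ (-z) = gagliardoKernel n δ z := by
  simp [gagliardoKernel]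

@[fun_prop]
theorem measurable_gagliardoKernel {n : ℕ} (δ : ℝ) : Measurable (gagliardoKernel n δ) := by
  unfold gagliardoKernel
  fun_prop

/-- Quadratic vanishing at the origin leaves |z|^{2-n-2δ}, locally integrable because δ < 1;
boundedness suffices at infinity because δ > 0. -/
theorem integrable_mul_gagliardoKernel {n : ℕ} (hn : 2 ≤ n) {δ : ℝ} (hδ0 : 0 < δ) (hδ1 : δ < 1)
    {f : Rn n → ℝ} (hf : Measurable f) {C₁ C₂ : ℝ} (h1 : ∀ z, |f z| ≤ C₁)
    (h2 : ∀ z, |f z| ≤ C₂ * ‖z‖ ^ 2) :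
    Integrable (fun z => f z * gagliardoKernel n δ z) := by
  have hm : Measurable (fun z => f z * gagliardoKernel n δ z) := by fun_prop
  have hC1 : 0 ≤ C₁ := (abs_nonneg _).trans (h1 0)
  have hnr : (2 : ℝ) ≤ n := by exact_mod_cast hn
  have hball : IntegrableOn (fun z => f z * gagliardoKernel n δ z) (Metric.ball 0 1) := by
    refine integrableOn_ball_of_norm_le_rpow (C := C₂) (α := n + 2 * δ - 2) ?_ ?_ ?_
      hm.aestronglyMeasurable
    · rw [finrank_euclideanSpace_fin]; omega
    · rw [finrank_euclideanSpace_fin]; linarith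
    · refine Eventually.of_forall fun z => ?_
      rw [norm_mul, Real.norm_eq_abs, Real.norm_of_nonneg (gagliardoKernel_nonneg δ z)]
      refine (mul_le_mul_of_nonneg_right (h2 z) (gagliardoKernel_nonneg δ z)).trans ?_
      rcases eq_or_ne z 0 with rfl | hz
      · have h3 : gagliardoKernel n δ (0 : Rn n) = 0 := by
          unfold gagliardoKernel
          rw [norm_zero, Real.zero_rpow]
          linarith
        have h4 : (0 : ℝ) ^ (-(n + 2 * δ - 2) : ℝ) = 0 := Real.zero_rpow (by linarith)
        rw [h3, norm_zero, h4]
        simp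
      · have hz' : 0 < ‖z‖ := norm_pos_iff.2 hz
        rw [mul_assoc, gagliardoKernel, ← Real.rpow_natCast, ← Real.rpow_add hz']
        apply le_of_eq
        congr 2
        push_cast
        ring
  have hcompl : IntegrableOn (fun z => f z * gagliardoKernel n δ z) (Metric.ball 0 1)ᶜ := by
    have hi : Integrable (fun z : Rn n => C₁ * (2 : ℝ) ^ (n + 2 * δ) *
        (1 + ‖z‖) ^ (-(n + 2 * δ) : ℝ)) := by
      refine Integrable.const_mul (integrable_one_add_norm ?_) _
      rw [finrank_euclideanSpace_fin]; linarith
    refine Integrable.mono' hi.integrableOn hm.aestronglyMeasurable ?_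
    refine (ae_restrict_iff' measurableSet_ball.compl).2 (Eventually.of_forall fun z hz => ?_)
    have hz1 : 1 ≤ ‖z‖ := by simpa using hz
    rw [norm_mul, Real.norm_eq_abs, Real.norm_of_nonneg (gagliardoKernel_nonneg δ z), mul_assoc]
    refine mul_le_mul (h1 z) ?_ (gagliardoKernel_nonneg δ z) hC1
    have h3 : (2 : ℝ) ^ (n + 2 * δ) * (1 + ‖z‖) ^ (-(n + 2 * δ) : ℝ)
        = ((1 + ‖z‖) / 2) ^ (-(n + 2 * δ) : ℝ) := by
      rw [Real.div_rpow (by positivity) (by norm_num), Real.rpow_neg (by norm_num : (0:ℝ) ≤ 2)]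
      field_simp
    rw [h3]
    exact Real.rpow_le_rpow_of_nonpos (by linarith) (by linarith) (by linarith)
  have := hball.union hcompl
  rwa [Set.union_compl_self, integrableOn_univ] at this

/-- The normalization in `|z|^{-n-2δ} = c ∫_0^∞ b^{n/2+δ-1} e^{-π b |z|²} db`. -/
def gaussianMixConst (n : ℕ) (δ : ℝ) : ℝ := Real.pi ^ (n / 2 + δ : ℝ) / Real.Gamma (n / 2 + δ)

theorem gaussianMixConst_pos {n : ℕ} {δ : ℝ} (hδ0 : 0 < δ) : 0 < gaussianMixConst n δ := by
  have : 0 < (n / 2 + δ : ℝ) := by positivity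
  exact div_pos (Real.rpow_pos_of_pos Real.pi_pos _) (Real.Gamma_pos_of_pos this)

theorem gagliardoKernel_eq_integral {n : ℕ} {δ : ℝ} (hδ0 : 0 < δ) {z : Rn n} (hz : z ≠ 0) :
    gagliardoKernel n δ z = gaussianMixConst n δ * ∫ b in Set.Ioi (0 : ℝ),
      b ^ (n / 2 + δ - 1 : ℝ) * Real.exp (-(Real.pi * b * ‖z‖ ^ 2)) := by
  have ha : 0 < (n / 2 + δ : ℝ) := by positivity
  have hz' : 0 < ‖z‖ := norm_pos_iff.2 hz
  have hr : 0 < Real.pi * ‖z‖ ^ 2 := by positivity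
  have h := Real.integral_rpow_mul_exp_neg_mul_Ioi ha hr
  have h2 : (fun b : ℝ => b ^ (n / 2 + δ - 1 : ℝ) * Real.exp (-(Real.pi * b * ‖z‖ ^ 2)))
      = fun b : ℝ => b ^ (n / 2 + δ - 1 : ℝ) * Real.exp (-(Real.pi * ‖z‖ ^ 2 * b)) := by
    ext b; congr 2; ring_nf
  rw [h2, h, gaussianMixConst, gagliardoKernel, one_div, Real.inv_rpow hr.le,
    Real.mul_rpow Real.pi_pos.le (by positivity), ← Real.rpow_natCast, ← Real.rpow_mul hz'.le,
    Real.rpow_neg hz'.le]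
  have hG := (Real.Gamma_pos_of_pos ha).ne'
  have hp := (Real.rpow_pos_of_pos Real.pi_pos (n / 2 + δ : ℝ)).ne'
  rw [show ((2 : ℕ) : ℝ) * (n / 2 + δ) = n + 2 * δ by push_cast; ring]
  field_simp

/-- Integrating the absolute value in b first gives back a multiple of |f| times the kernel, so the
joint integrability needed for Fubini follows from the previous criterion. -/
theorem integrable_prod_gaussianMix {n : ℕ} (hn : 2 ≤ n) {δ : ℝ} (hδ0 : 0 < δ) (hδ1 : δ < 1)
    {f : Rn n → ℝ} (hf : Measurable f) {C₁ C₂ : ℝ} (h1 : ∀ z, |f z| ≤ C₁)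
    (h2 : ∀ z, |f z| ≤ C₂ * ‖z‖ ^ 2) :
    Integrable (fun p : Rn n × ℝ => p.2 ^ (n / 2 + δ - 1 : ℝ) *
        (f p.1 * Real.exp (-(Real.pi * p.2 * ‖p.1‖ ^ 2))))
      ((volume : Measure (Rn n)).prod (volume.restrict (Set.Ioi 0))) := by
  have hc := gaussianMixConst_pos (n := n) hδ0
  have ha : 0 < (n / 2 + δ : ℝ) := by positivity
  have hnt : Nontrivial (Rn n) := by
    apply Module.nontrivial_of_finrank_pos (R := ℝ)
    rw [finrank_euclideanSpace_fin]; omega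
  have hm : Measurable (fun p : Rn n × ℝ => p.2 ^ (n / 2 + δ - 1 : ℝ) *
        (f p.1 * Real.exp (-(Real.pi * p.2 * ‖p.1‖ ^ 2)))) := by fun_prop
  have hae : ∀ᵐ z : Rn n, z ≠ 0 := by
    simp [ae_iff]
  refine (integrable_prod_iff hm.aestronglyMeasurable).2 ⟨?_, ?_⟩
  · filter_upwards [hae] with z hz
    have hz' : 0 < ‖z‖ := norm_pos_iff.2 hz
    have h3 : IntegrableOn (fun b : ℝ => b ^ (n / 2 + δ - 1 : ℝ) *
        Real.exp (-(Real.pi * ‖z‖ ^ 2) * b ^ (1:ℝ))) (Set.Ioi 0) :=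
      integrableOn_rpow_mul_exp_neg_mul_rpow (by linarith) one_pos (by positivity)
    refine (h3.const_mul (f z)).congr (Eventually.of_forall fun b => ?_)
    simp only [Real.rpow_one]
    ring_nf
  · have hi := (integrable_mul_gagliardoKernel hn hδ0 hδ1 hf h1 h2).norm.const_mul
      (gaussianMixConst n δ)⁻¹
    refine hi.congr ?_
    filter_upwards [hae] with z hz
    rw [norm_mul, Real.norm_of_nonneg (gagliardoKernel_nonneg δ z),
      gagliardoKernel_eq_integral hδ0 hz]
    rw [mul_left_comm, inv_mul_cancel_left₀ hc.ne', ← integral_const_mul]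
    refine setIntegral_congr_fun measurableSet_Ioi fun b hb => ?_
    have hb' : (0 : ℝ) < b := hb
    simp only [norm_mul, Real.norm_of_nonneg (Real.exp_nonneg _),
      Real.norm_of_nonneg (Real.rpow_nonneg hb'.le _)]
    ring

/-- Subordination: integrals against the homogeneous kernel reduce to Gaussian integrals, which are
explicit for the oscillating f used below. -/
theorem integral_mul_gagliardoKernel {n : ℕ} (hn : 2 ≤ n) {δ : ℝ} (hδ0 : 0 < δ) (hδ1 : δ < 1)
    {f : Rn n → ℝ} (hf : Measurable f) {C₁ C₂ : ℝ} (h1 : ∀ z, |f z| ≤ C₁)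
    (h2 : ∀ z, |f z| ≤ C₂ * ‖z‖ ^ 2) :
    ∫ z, f z * gagliardoKernel n δ z = gaussianMixConst n δ * ∫ b in Set.Ioi (0 : ℝ),
      b ^ (n / 2 + δ - 1 : ℝ) * ∫ z, f z * Real.exp (-(Real.pi * b * ‖z‖ ^ 2)) := by
  have hnt : Nontrivial (Rn n) := by
    apply Module.nontrivial_of_finrank_pos (R := ℝ)
    rw [finrank_euclideanSpace_fin]; omega
  have hae : ∀ᵐ z : Rn n, z ≠ 0 := by simp [ae_iff]
  have hi := integrable_prod_gaussianMix hn hδ0 hδ1 hf h1 h2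
  have hs := integral_integral_swap (f := fun (z : Rn n) (b : ℝ) => b ^ (n / 2 + δ - 1 : ℝ) *
        (f z * Real.exp (-(Real.pi * b * ‖z‖ ^ 2)))) hi
  simp_rw [integral_const_mul] at hs
  rw [← hs, ← integral_const_mul]
  refine integral_congr_ae ?_
  filter_upwards [hae] with z hz
  rw [gagliardoKernel_eq_integral hδ0 hz, mul_left_comm, ← integral_const_mul (f z)]
  congr 2
  ext b
  ring

theorem integrableOn_gaussianMix {n : ℕ} (hn : 2 ≤ n) {δ : ℝ} (hδ0 : 0 < δ) (hδ1 : δ < 1)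
    {f : Rn n → ℝ} (hf : Measurable f) {C₁ C₂ : ℝ} (h1 : ∀ z, |f z| ≤ C₁)
    (h2 : ∀ z, |f z| ≤ C₂ * ‖z‖ ^ 2) :
    IntegrableOn (fun b : ℝ => b ^ (n / 2 + δ - 1 : ℝ) *
      ∫ z, f z * Real.exp (-(Real.pi * b * ‖z‖ ^ 2))) (Set.Ioi 0) := by
  have h := (integrable_prod_gaussianMix hn hδ0 hδ1 hf h1 h2).integral_prod_right
  simp only [integral_const_mul] at h
  exact h

/-! ### Gaussian integrals with complex variance -/

/-- The profile `ζ^{-m} e^{-X/ζ}` of a Gaussian integral with complex variance `ζ`. -/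
def gaussianProfile (m X : ℝ) (ζ : ℂ) : ℂ := ζ⁻¹ ^ (m : ℂ) * Complex.exp (-(X * ζ⁻¹))

theorem integral_cexp_gaussian {n : ℕ} (x : Rn n) {ζ : ℂ} (hζ : 0 < ζ.re) :
    ∫ v : Rn n, Complex.exp (-(Real.pi * ζ) * ‖v‖ ^ 2 + (2 * Real.pi * Complex.I) * (inner ℝ x v : ℝ))
      = gaussianProfile (n / 2) (Real.pi * ‖x‖ ^ 2) ζ := by
  have hζ0 : ζ ≠ 0 := by rintro rfl; simp at hζ
  have hpi : (Real.pi : ℂ) ≠ 0 := by exact_mod_cast Real.pi_ne_zero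
  have hre : 0 < ((Real.pi : ℂ) * ζ).re := by
    rw [Complex.re_ofReal_mul]; exact mul_pos Real.pi_pos hζ
  rw [GaussianFourier.integral_cexp_neg_mul_sq_norm_add hre, finrank_euclideanSpace_fin,
    gaussianProfile]
  congr 2
  · field_simp
  · push_cast; ring
  · push_cast
    field_simp
    ring_nf
    simp

theorem integrable_cos_mul_exp {n : ℕ} (x : Rn n) {b : ℝ} (hb : 0 < b) (y : ℝ) :
    Integrable (fun v : Rn n => Real.cos (2 * Real.pi * inner ℝ x v - Real.pi * y * ‖v‖ ^ 2) *
      Real.exp (-(Real.pi * b * ‖v‖ ^ 2))) := by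
  have hre : 0 < ((Real.pi * b : ℝ) : ℂ).re := by
    rw [Complex.ofReal_re]; positivity
  have h := (GaussianFourier.integrable_cexp_neg_mul_sq_norm_add hre 0 (0 : Rn n)).norm
  refine Integrable.mono' h (by fun_prop) (Eventually.of_forall fun v => ?_)
  rw [Complex.norm_exp, norm_mul, Real.norm_of_nonneg (Real.exp_nonneg _), Real.norm_eq_abs]
  have h2 : (-((Real.pi * b : ℝ) : ℂ) * ‖v‖ ^ 2 + 0 * (inner ℝ (0 : Rn n) v : ℝ)).re
      = -(Real.pi * b * ‖v‖ ^ 2) := by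
    rw [zero_mul, add_zero, ← Complex.ofReal_neg, ← Complex.ofReal_pow, ← Complex.ofReal_mul,
      Complex.ofReal_re]
    ring
  rw [h2]
  exact mul_le_of_le_one_left (Real.exp_nonneg _) (Real.abs_cos_le_one _)

/-- A quadratic phase only makes the variance complex: the factor e^{-iπy|v|²} moves b to b + iy. -/
theorem integral_cos_mul_exp {n : ℕ} (x : Rn n) {b : ℝ} (hb : 0 < b) (y : ℝ) :
    ∫ v : Rn n, Real.cos (2 * Real.pi * inner ℝ x v - Real.pi * y * ‖v‖ ^ 2) *
      Real.exp (-(Real.pi * b * ‖v‖ ^ 2))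
      = (gaussianProfile (n / 2) (Real.pi * ‖x‖ ^ 2) (b + y * Complex.I)).re := by
  have hre : 0 < ((b : ℂ) + y * Complex.I).re := by simpa using hb
  have hre' : 0 < ((Real.pi : ℂ) * (b + y * Complex.I)).re := by
    rw [Complex.re_ofReal_mul]; exact mul_pos Real.pi_pos hre
  rw [← integral_cexp_gaussian x hre]
  have hi := GaussianFourier.integrable_cexp_neg_mul_sq_norm_add hre' (2 * Real.pi * Complex.I) x
  have h := integral_re hi
  simp only [RCLike.re_to_complex] at h
  rw [← h]
  congr 1
  ext v
  have h2 : -((Real.pi : ℂ) * (b + y * Complex.I)) * (‖v‖ : ℂ) ^ 2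
      + 2 * Real.pi * Complex.I * (inner ℝ x v : ℝ)
      = ((-(Real.pi * b * ‖v‖ ^ 2) : ℝ) : ℂ)
        + ((2 * Real.pi * inner ℝ x v - Real.pi * y * ‖v‖ ^ 2 : ℝ) : ℂ) * Complex.I := by
    push_cast; ring
  rw [h2, Complex.exp_re]
  simp only [Complex.add_re, Complex.add_im, Complex.ofReal_re, Complex.ofReal_im,
    Complex.re_ofReal_mul, Complex.im_ofReal_mul, Complex.I_re, Complex.I_im, mul_zero, mul_one,
    add_zero, zero_add]
  ring

/-! ### The symbol |x|^{2δ} as an integral of 1 - cos -/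

theorem abs_one_sub_cos_le (a : ℝ) : |1 - Real.cos a| ≤ 2 := by
  rw [abs_le]; constructor <;> linarith [Real.cos_le_one a, Real.neg_one_le_cos a]

theorem abs_one_sub_cos_le_sq (a : ℝ) : |1 - Real.cos a| ≤ a ^ 2 := by
  rw [abs_of_nonneg (by linarith [Real.cos_le_one a])]
  nlinarith [Real.one_sub_sq_div_two_le_cos (x := a), sq_nonneg a]

theorem abs_one_sub_cos_le_abs (a : ℝ) : |1 - Real.cos a| ≤ 2 * |a| := by
  rcases le_or_gt |a| 1 with h | h
  · refine (abs_one_sub_cos_le_sq a).trans ?_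
    rw [← sq_abs]; nlinarith [abs_nonneg a]
  · exact (abs_one_sub_cos_le a).trans (by linarith)

theorem inner_sq_le {n : ℕ} (x z : Rn n) : (inner ℝ x z) ^ 2 ≤ ‖x‖ ^ 2 * ‖z‖ ^ 2 := by
  rw [← mul_pow, ← sq_abs]
  exact pow_le_pow_left₀ (abs_nonneg _) (abs_real_inner_le_norm x z) 2

theorem abs_one_sub_cos_inner_le {n : ℕ} (x z : Rn n) :
    |1 - Real.cos (2 * Real.pi * inner ℝ x z)| ≤ (2 * Real.pi) ^ 2 * ‖x‖ ^ 2 * ‖z‖ ^ 2 := by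
  refine (abs_one_sub_cos_le_sq _).trans ?_
  rw [mul_pow, mul_assoc]
  exact mul_le_mul_of_nonneg_left (inner_sq_le x z) (by positivity)

/-- The constant `κ` in `∫ (1 - cos (2π x·z)) |z|^{-n-2δ} dz = κ |x|^{2δ}`. -/
def flatConst (n : ℕ) (δ : ℝ) : ℝ :=
  gaussianMixConst n δ * ∫ b in Set.Ioi (0 : ℝ), b ^ (δ - 1) * (1 - Real.exp (-(Real.pi * b⁻¹)))

theorem integrable_one_sub_cos_inner {n : ℕ} (hn : 2 ≤ n) {δ : ℝ} (hδ0 : 0 < δ) (hδ1 : δ < 1)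
    (x : Rn n) :
    Integrable (fun z => (1 - Real.cos (2 * Real.pi * inner ℝ x z)) * gagliardoKernel n δ z) :=
  integrable_mul_gagliardoKernel hn hδ0 hδ1 (by fun_prop) (fun _ => abs_one_sub_cos_le _)
    (abs_one_sub_cos_inner_le x)

theorem integral_one_sub_cos_mul_exp {n : ℕ} (x : Rn n) {b : ℝ} (hb : 0 < b) :
    ∫ z : Rn n, (1 - Real.cos (2 * Real.pi * inner ℝ x z)) * Real.exp (-(Real.pi * b * ‖z‖ ^ 2))
      = b ^ (-(n / 2) : ℝ) * (1 - Real.exp (-(Real.pi * ‖x‖ ^ 2 * b⁻¹))) := by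
  have h0 := integral_cos_mul_exp (0 : Rn n) hb 0
  have h1 := integral_cos_mul_exp x hb 0
  have i0 := integrable_cos_mul_exp (0 : Rn n) hb 0
  have i1 := integrable_cos_mul_exp x hb 0
  simp only [inner_zero_left, mul_zero, zero_mul, sub_zero, Real.cos_zero, one_mul] at h0 h1 i0 i1
  simp_rw [sub_mul, one_mul]
  have hp (X : ℝ) : (gaussianProfile (n / 2) X b).re
      = b ^ (-(n / 2) : ℝ) * Real.exp (-(X * b⁻¹)) := by
    unfold gaussianProfile
    rw [← Complex.ofReal_inv, ← Complex.ofReal_cpow (by positivity), ← Complex.ofReal_mul,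
      ← Complex.ofReal_neg, ← Complex.ofReal_exp, ← Complex.ofReal_mul, Complex.ofReal_re,
      Real.inv_rpow hb.le, Real.rpow_neg hb.le]
  rw [integral_sub i0 i1, h0, h1]
  simp only [Complex.ofReal_zero, zero_mul, add_zero, hp, norm_zero]
  simp
  ring

theorem integral_one_sub_cos_inner_eq {n : ℕ} (hn : 2 ≤ n) {δ : ℝ} (hδ0 : 0 < δ) (hδ1 : δ < 1)
    (x : Rn n) :
    ∫ z, (1 - Real.cos (2 * Real.pi * inner ℝ x z)) * gagliardoKernel n δ z
      = gaussianMixConst n δ * ∫ b in Set.Ioi (0 : ℝ),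
        b ^ (δ - 1) * (1 - Real.exp (-(Real.pi * ‖x‖ ^ 2 * b⁻¹))) := by
  rw [integral_mul_gagliardoKernel hn hδ0 hδ1 (by fun_prop) (fun _ => abs_one_sub_cos_le _)
    (abs_one_sub_cos_inner_le x)]
  congr 1
  refine setIntegral_congr_fun measurableSet_Ioi fun b hb => ?_
  have hb' : (0 : ℝ) < b := hb
  rw [integral_one_sub_cos_mul_exp x hb', ← mul_assoc, ← Real.rpow_add hb']
  congr 2
  ring

/-- Homogeneity: in the subordinated integral the substitution b → |x|²b extracts |x|^{2δ} and
leaves the constant. -/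
theorem integral_one_sub_cos_inner {n : ℕ} (hn : 2 ≤ n) {δ : ℝ} (hδ0 : 0 < δ) (hδ1 : δ < 1)
    (x : Rn n) :
    ∫ z, (1 - Real.cos (2 * Real.pi * inner ℝ x z)) * gagliardoKernel n δ z
      = flatConst n δ * ‖x‖ ^ (2 * δ) := by
  rcases eq_or_ne x 0 with rfl | hx
  · simp [Real.zero_rpow (by positivity : 2 * δ ≠ 0)]
  have hx' : 0 < ‖x‖ := norm_pos_iff.2 hx
  have hx2 : 0 < ‖x‖ ^ 2 := by positivity
  rw [integral_one_sub_cos_inner_eq hn hδ0 hδ1, flatConst, mul_assoc]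
  congr 1
  have h := integral_comp_mul_left_Ioi
    (fun b : ℝ => b ^ (δ - 1) * (1 - Real.exp (-(Real.pi * ‖x‖ ^ 2 * b⁻¹)))) 0 hx2
  rw [mul_zero, smul_eq_mul] at h
  rw [← mul_right_inj' (inv_ne_zero hx2.ne'), ← h, ← integral_mul_const, ← integral_const_mul]
  refine setIntegral_congr_fun measurableSet_Ioi fun b hb => ?_
  have hb' : (0 : ℝ) < b := hb
  rw [Real.mul_rpow hx2.le hb'.le, mul_inv, Real.rpow_sub_one hx2.ne', ← Real.rpow_natCast,
    ← Real.rpow_mul hx'.le]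
  rw [Real.rpow_natCast]
  have : Real.pi * ‖x‖ ^ 2 * ((‖x‖ ^ 2)⁻¹ * b⁻¹) = Real.pi * b⁻¹ := by field_simp
  rw [this]
  push_cast
  field_simp

theorem flatConst_pos {n : ℕ} (hn : 2 ≤ n) {δ : ℝ} (hδ0 : 0 < δ) (hδ1 : δ < 1) :
    0 < flatConst n δ := by
  refine mul_pos (gaussianMixConst_pos hδ0) ?_
  have hpos : ∀ b ∈ Set.Ioi (0 : ℝ), 0 < b ^ (δ - 1) * (1 - Real.exp (-(Real.pi * b⁻¹))) := by
    intro b hb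
    have hb' : (0 : ℝ) < b := hb
    refine mul_pos (Real.rpow_pos_of_pos hb' _) ?_
    have : Real.exp (-(Real.pi * b⁻¹)) < 1 := by
      rw [Real.exp_lt_one_iff]
      have : 0 < Real.pi * b⁻¹ := by positivity
      linarith
    linarith
  have hint : IntegrableOn (fun b : ℝ => b ^ (δ - 1) * (1 - Real.exp (-(Real.pi * b⁻¹))))
      (Set.Ioi 0) := by
    -- At a unit vector the subordinated integrand is exactly the one defining the constant, so its
    -- integrability is inherited.
    let x : Rn n := EuclideanSpace.single ⟨0, by omega⟩ 1
    have hx : ‖x‖ = 1 := by simp [x]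
    refine (integrableOn_gaussianMix hn hδ0 hδ1 (f := fun z => 1 - Real.cos (2 * Real.pi * inner ℝ x z))
      (by fun_prop) (fun _ => abs_one_sub_cos_le _)
      (abs_one_sub_cos_inner_le x)).congr_fun ?_ measurableSet_Ioi
    intro b hb
    have hb' : (0 : ℝ) < b := hb
    simp only
    rw [integral_one_sub_cos_mul_exp x hb', ← mul_assoc, ← Real.rpow_add hb', hx]
    congr 2
    · ring
    · simp
  rw [setIntegral_pos_iff_support_of_nonneg_ae]
  · have : Function.support (fun b : ℝ => b ^ (δ - 1) * (1 - Real.exp (-(Real.pi * b⁻¹))))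
        ∩ Set.Ioi 0 = Set.Ioi 0 := by
      apply Set.inter_eq_right.2
      intro b hb
      exact (hpos b hb).ne'
    rw [this]
    simp
  · exact (ae_restrict_iff' measurableSet_Ioi).2 (Eventually.of_forall fun b hb => (hpos b hb).le)
  · exact hint

/-! ### Derivatives and second differences of the Gaussian profile -/

theorem norm_gaussianProfile (m X : ℝ) {ζ : ℂ} (hζ : 0 < ζ.re) :
    ‖gaussianProfile m X ζ‖ = ‖ζ‖⁻¹ ^ m * Real.exp (-(X * (ζ.re / ‖ζ‖ ^ 2))) := by
  have hζ0 : ζ ≠ 0 := by rintro rfl; simp at hζ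
  rw [gaussianProfile, norm_mul, Complex.norm_cpow_real, norm_inv, Complex.norm_exp,
    Complex.neg_re, Complex.re_ofReal_mul, Complex.inv_re, Complex.normSq_eq_norm_sq]

theorem hasDerivAt_gaussianProfile (m X : ℝ) {ζ : ℂ} (hζ : 0 < ζ.re) :
    HasDerivAt (gaussianProfile m X)
      (gaussianProfile m X ζ * (X * ζ⁻¹ ^ 2 - m * ζ⁻¹)) ζ := by
  have hζ0 : ζ ≠ 0 := by rintro rfl; simp at hζ
  have hinv : HasDerivAt (fun ζ : ℂ => ζ⁻¹) (-(ζ ^ 2)⁻¹) ζ := hasDerivAt_inv hζ0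
  have hslit : ζ⁻¹ ∈ Complex.slitPlane := by
    left
    rw [Complex.inv_re]
    exact div_pos hζ (Complex.normSq_pos.2 hζ0)
  have h1 := hinv.cpow_const (c := (m : ℂ)) hslit
  have h2 : HasDerivAt (fun ζ : ℂ => Complex.exp (-(X * ζ⁻¹)))
      (Complex.exp (-(X * ζ⁻¹)) * -(X * -(ζ ^ 2)⁻¹)) ζ := ((hinv.const_mul (X : ℂ)).neg).cexp
  refine (h1.mul h2).congr_deriv ?_
  rw [gaussianProfile, Complex.cpow_sub _ _ (inv_ne_zero hζ0), Complex.cpow_one]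
  field_simp
  ring

theorem hasDerivAt_gaussianProfile_deriv (m X : ℝ) {ζ : ℂ} (hζ : 0 < ζ.re) :
    HasDerivAt (fun ζ : ℂ => gaussianProfile m X ζ * (X * ζ⁻¹ ^ 2 - m * ζ⁻¹))
      (gaussianProfile m X ζ * ((X * ζ⁻¹ ^ 2 - m * ζ⁻¹) ^ 2 + (m * ζ⁻¹ ^ 2 - 2 * X * ζ⁻¹ ^ 3))) ζ := by
  have hζ0 : ζ ≠ 0 := by rintro rfl; simp at hζ
  have hinv : HasDerivAt (fun ζ : ℂ => ζ⁻¹) (-(ζ ^ 2)⁻¹) ζ := hasDerivAt_inv hζ0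
  have h1 := ((hinv.pow 2).const_mul (X : ℂ)).sub (hinv.const_mul (m : ℂ))
  refine ((hasDerivAt_gaussianProfile m X hζ).mul h1).congr_deriv ?_
  simp
  field_simp
  ring

/-- With u = X/b the bracket is at most 4m²(1+u)²b^{-2}, while the profile is at most
b^{-m}e^{-u/2}. The exponential absorbs (1+u)² and still yields 1/u = b/X, which trades one power of
b for the decay 1/X. -/
theorem norm_gaussianProfile_second_deriv_le {m X : ℝ} (hm : 1 ≤ m) (hX : 0 < X) {b : ℝ}
    (hb : 1 ≤ b) {y : ℝ} (hy : |y| ≤ 1) :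
    ‖gaussianProfile m X (b + y * Complex.I) *
      ((X * (b + y * Complex.I : ℂ)⁻¹ ^ 2 - m * (b + y * Complex.I : ℂ)⁻¹) ^ 2
        + (m * (b + y * Complex.I : ℂ)⁻¹ ^ 2 - 2 * X * (b + y * Complex.I : ℂ)⁻¹ ^ 3))‖
      ≤ 400 * m ^ 2 * b ^ (-m - 1) / X := by
  have hb0 : 0 < b := by linarith
  set ζ : ℂ := b + y * Complex.I with hζdef
  have hre : ζ.re = b := by simp [hζdef]
  have him : ζ.im = y := by simp [hζdef]
  have hre0 : 0 < ζ.re := by rw [hre]; exact hb0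
  have hnsq : ‖ζ‖ ^ 2 = b ^ 2 + y ^ 2 := by
    rw [← Complex.normSq_eq_norm_sq, Complex.normSq_apply, hre, him]; ring
  have hy2 : y ^ 2 ≤ 1 := by rw [← sq_abs]; nlinarith [abs_nonneg y]
  have hbn : b ≤ ‖ζ‖ := by
    have := Complex.abs_re_le_norm ζ
    rwa [hre, abs_of_pos hb0] at this
  have hn0 : 0 < ‖ζ‖ := by linarith
  have hinv : ‖ζ‖⁻¹ ≤ b⁻¹ := inv_anti₀ hb0 hbn
  set u : ℝ := X / b with hu
  have hu0 : 0 < u := by positivity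
  have hP : ‖gaussianProfile m X ζ‖ ≤ b ^ (-m) * Real.exp (-(u / 2)) := by
    rw [norm_gaussianProfile m X hre0]
    refine mul_le_mul ?_ ?_ (Real.exp_nonneg _) (by positivity)
    · rw [Real.rpow_neg hb0.le, ← Real.inv_rpow hb0.le]
      exact Real.rpow_le_rpow (by positivity) hinv (by linarith)
    · apply Real.exp_le_exp.2
      rw [hre, hnsq, neg_le_neg_iff, hu]
      -- Here |y| ≤ 1 ≤ b gives b² + y² ≤ 2b².
      have h1 : b⁻¹ / 2 ≤ b / (b ^ 2 + y ^ 2) := by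
        rw [div_le_div_iff₀ (by norm_num) (by positivity)]
        field_simp
        nlinarith
      calc X / b / 2 = X * (b⁻¹ / 2) := by ring
        _ ≤ _ := mul_le_mul_of_nonneg_left h1 hX.le
  have hbr : ‖(X * ζ⁻¹ ^ 2 - m * ζ⁻¹) ^ 2 + (m * ζ⁻¹ ^ 2 - 2 * X * ζ⁻¹ ^ 3)‖
      ≤ 4 * m ^ 2 * (1 + u) ^ 2 * b⁻¹ ^ 2 := by
    have hz : ‖ζ⁻¹‖ ≤ b⁻¹ := by rw [norm_inv]; exact hinv
    have hnX : ‖(X : ℂ)‖ = X := by simp [abs_of_pos hX]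
    have hnm : ‖(m : ℂ)‖ = m := by simp [abs_of_pos (by linarith : 0 < m)]
    have hXu : X = u * b := by rw [hu]; field_simp
    have h1 : ‖(X : ℂ) * ζ⁻¹ ^ 2 - m * ζ⁻¹‖ ≤ (u + m) * b⁻¹ := by
      calc _ ≤ ‖(X : ℂ) * ζ⁻¹ ^ 2‖ + ‖(m : ℂ) * ζ⁻¹‖ := norm_sub_le _ _
        _ ≤ X * b⁻¹ ^ 2 + m * b⁻¹ := by
          rw [norm_mul, norm_mul, norm_pow, hnX, hnm]; gcongr
        _ = _ := by rw [hXu]; field_simp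
    have h2 : ‖(m : ℂ) * ζ⁻¹ ^ 2 - 2 * X * ζ⁻¹ ^ 3‖ ≤ (m + 2 * u) * b⁻¹ ^ 2 := by
      calc _ ≤ ‖(m : ℂ) * ζ⁻¹ ^ 2‖ + ‖2 * (X : ℂ) * ζ⁻¹ ^ 3‖ := norm_sub_le _ _
        _ ≤ m * b⁻¹ ^ 2 + 2 * X * b⁻¹ ^ 3 := by
          rw [norm_mul, norm_mul, norm_mul, norm_pow, norm_pow, hnX, hnm, Complex.norm_ofNat]
          gcongr
        _ = _ := by rw [hXu]; field_simp
    calc _ ≤ ‖((X : ℂ) * ζ⁻¹ ^ 2 - m * ζ⁻¹)‖ ^ 2 + ‖(m : ℂ) * ζ⁻¹ ^ 2 - 2 * X * ζ⁻¹ ^ 3‖ := by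
          rw [← norm_pow]; exact norm_add_le _ _
      _ ≤ ((u + m) * b⁻¹) ^ 2 + (m + 2 * u) * b⁻¹ ^ 2 := by gcongr
      _ = ((u + m) ^ 2 + m + 2 * u) * b⁻¹ ^ 2 := by ring
      _ ≤ _ := by
        gcongr
        have hm2 : m ≤ m ^ 2 := by nlinarith
        have h3 : u + m ≤ m * (1 + u) := by nlinarith
        have h4 : (u + m) ^ 2 ≤ (m * (1 + u)) ^ 2 := by gcongr
        have h5 : m + 2 * u ≤ m ^ 2 * (1 + 2 * u) := by nlinarith
        nlinarith [sq_nonneg (m * u), sq_nonneg m]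
  -- The cubic Taylor term of exp at (1+u)/2 is (1+u)³/48; with e^{1/2} ≤ 2 this gives the constant
  -- 96 = 2·48.
  have hexp : Real.exp (-(u / 2)) * (1 + u) ^ 2 ≤ 96 / u := by
    have h1 := Real.pow_div_factorial_le_exp (x := (1 + u) / 2) (by positivity) 3
    have h2 : Real.exp ((1 + u) / 2) = Real.exp (1 / 2) * Real.exp (u / 2) := by
      rw [← Real.exp_add]; congr 1; ring
    have h3 : Real.exp (1 / 2) ≤ 2 := by
      have h4 : Real.exp (1 / 2) ^ 2 = Real.exp 1 := by rw [← Real.exp_nat_mul]; norm_num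
      nlinarith [Real.exp_one_lt_d9, Real.exp_pos (1 / 2 : ℝ)]
    have h6 : (1 + u) ^ 3 ≤ 96 * Real.exp (u / 2) := by
      rw [h2] at h1
      have : ((1 + u) / 2) ^ 3 / (Nat.factorial 3 : ℝ) = (1 + u) ^ 3 / 48 := by
        norm_num [Nat.factorial]; ring
      rw [this] at h1
      nlinarith [Real.exp_pos (u / 2 : ℝ)]
    rw [Real.exp_neg, le_div_iff₀ hu0, mul_assoc, inv_mul_le_iff₀ (Real.exp_pos _)]
    nlinarith [sq_nonneg (1 + u)]
  rw [norm_mul]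
  calc _ ≤ (b ^ (-m) * Real.exp (-(u / 2))) * (4 * m ^ 2 * (1 + u) ^ 2 * b⁻¹ ^ 2) := by gcongr
    _ = b ^ (-m) * (4 * m ^ 2) * b⁻¹ ^ 2 * (Real.exp (-(u / 2)) * (1 + u) ^ 2) := by ring
    _ ≤ b ^ (-m) * (4 * m ^ 2) * b⁻¹ ^ 2 * (96 / u) := by gcongr
    _ = 384 * m ^ 2 * b ^ (-m - 1) / X := by
      rw [hu, Real.rpow_sub_one hb0.ne']; field_simp; ring
    _ ≤ _ := by gcongr; norm_num

/-- The second difference of the Gaussian profile in the imaginary direction. -/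
def profileSecondDiff (m X b : ℝ) : ℂ :=
  gaussianProfile m X b - (1 / 2) * gaussianProfile m X (b + Complex.I)
    - (1 / 2) * gaussianProfile m X (b - Complex.I)

/-- The mean value inequality is applied twice: on [-y, y] to the derivative, then on [0, 1] to the
even sum. The exponent -m-1 turns the subordination weight b^{m+δ-1} into b^{δ-2}, integrable at
infinity since δ < 1. -/
theorem norm_profileSecondDiff_le_of_one_le {m X : ℝ} (hm : 1 ≤ m) (hX : 0 < X) {b : ℝ}
    (hb : 1 ≤ b) : ‖profileSecondDiff m X b‖ ≤ 400 * m ^ 2 * b ^ (-m - 1) / X := by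
  set K := 400 * m ^ 2 * b ^ (-m - 1) / X with hK
  set g : ℂ → ℂ := fun ζ => gaussianProfile m X ζ * (X * ζ⁻¹ ^ 2 - m * ζ⁻¹) with hg
  have hK0 : 0 ≤ K := by positivity
  have hline (s : ℂ) (y : ℝ) : HasDerivAt (fun y : ℝ => (b : ℂ) + y * s) s y := by
    simpa using ((Complex.ofRealCLM.hasDerivAt (x := y)).mul_const s).const_add (b : ℂ)
  have hre (y : ℝ) : 0 < ((b : ℂ) + y * Complex.I).re := by simp; linarith
  have hre' (y : ℝ) : 0 < ((b : ℂ) + y * (-Complex.I)).re := by simp; linarith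
  -- first derivative of the symmetric difference
  have hg1 (y : ℝ) (hy : y ∈ Set.Icc (0 : ℝ) 1) :
      ‖g (b + y * Complex.I) - g (b + y * (-Complex.I))‖ ≤ 2 * K := by
    have hder (s : ℝ) (hs : s ∈ Set.Icc (-1 : ℝ) 1) :
        HasDerivWithinAt (fun s : ℝ => g (b + s * Complex.I))
          (gaussianProfile m X (b + s * Complex.I) *
            ((X * (b + s * Complex.I : ℂ)⁻¹ ^ 2 - m * (b + s * Complex.I : ℂ)⁻¹) ^ 2
            + (m * (b + s * Complex.I : ℂ)⁻¹ ^ 2 - 2 * X * (b + s * Complex.I : ℂ)⁻¹ ^ 3))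
            * Complex.I) (Set.Icc (-1) 1) s :=
      (HasDerivAt.comp (h₂ := g) (h := fun y : ℝ => (b : ℂ) + y * Complex.I) s
        (hasDerivAt_gaussianProfile_deriv m X (hre s)) (hline Complex.I s)).hasDerivWithinAt
    have hbd (s : ℝ) (hs : s ∈ Set.Icc (-1 : ℝ) 1) := by
      have := norm_gaussianProfile_second_deriv_le hm hX hb (abs_le.2 hs)
      exact this
    have := (convex_Icc (-1 : ℝ) 1).norm_image_sub_le_of_norm_hasDerivWithin_le (C := K) hder
      (fun s hs => by rw [norm_mul, Complex.norm_I, mul_one]; exact hbd s hs)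
      (x := -y) (y := y) ⟨by linarith [hy.2], by linarith [hy.1]⟩ ⟨by linarith [hy.1], hy.2⟩
    have h2 : ((b : ℂ) + ((-y : ℝ) : ℂ) * Complex.I) = b + y * (-Complex.I) := by push_cast; ring
    rw [h2] at this
    refine this.trans ?_
    rw [mul_comm]
    refine mul_le_mul_of_nonneg_right ?_ hK0
    rw [Real.norm_eq_abs, abs_of_nonneg (by linarith [hy.1])]
    linarith [hy.2]
  have hder (y : ℝ) (hy : y ∈ Set.Icc (0 : ℝ) 1) :
      HasDerivWithinAt (fun y : ℝ => gaussianProfile m X (b + y * Complex.I)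
          + gaussianProfile m X (b + y * (-Complex.I)))
        ((g (b + y * Complex.I) - g (b + y * (-Complex.I))) * Complex.I) (Set.Icc 0 1) y := by
    have h1 := (hasDerivAt_gaussianProfile m X (hre y)).comp y (hline Complex.I y)
    have h2 := (hasDerivAt_gaussianProfile m X (hre' y)).comp y (hline (-Complex.I) y)
    refine ((h1.add h2).congr_deriv ?_).hasDerivWithinAt
    rw [hg]; ring
  have h := (convex_Icc (0 : ℝ) 1).norm_image_sub_le_of_norm_hasDerivWithin_le (C := 2 * K) hder
    (fun s hs => by rw [norm_mul, Complex.norm_I, mul_one]; exact hg1 s hs)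
    (x := 0) (y := 1) (by simp) (by simp)
  have h2 : profileSecondDiff m X b = -(1 / 2) * (gaussianProfile m X (b + (1 : ℝ) * Complex.I)
          + gaussianProfile m X (b + (1 : ℝ) * (-Complex.I))
      - (gaussianProfile m X (b + (0 : ℝ) * Complex.I)
          + gaussianProfile m X (b + (0 : ℝ) * (-Complex.I)))) := by
    rw [profileSecondDiff]
    simp
    ring_nf
  rw [h2, norm_mul]
  have h3 : ‖(-(1 / 2) : ℂ)‖ = 1 / 2 := by rw [norm_neg]; norm_num
  rw [h3]
  simp only [sub_zero, norm_one, mul_one] at h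
  linarith

theorem exp_neg_le_inv {u : ℝ} (hu : 0 < u) : Real.exp (-u) ≤ u⁻¹ := by
  rw [Real.exp_neg]
  exact inv_anti₀ hu (by linarith [Real.add_one_le_exp u])

/-- No cancellation is needed for small b. At b ± i the modulus is at least 1 and the real part of
the inverse at least b/2, so e^{-v} ≤ 1/v gives 2/(bX), and m ≥ 1 bounds this by 2b^{-m}/X. -/
theorem norm_profileSecondDiff_le_of_le_one {m X : ℝ} (hm : 1 ≤ m) (hX : 0 < X) {b : ℝ}
    (hb0 : 0 < b) (hb : b ≤ 1) : ‖profileSecondDiff m X b‖ ≤ 3 * b ^ (-m) / X := by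
  have key (y : ℝ) (hy : y ^ 2 = 1) :
      ‖gaussianProfile m X (b + y * Complex.I)‖ ≤ 2 * b ^ (-m) / X := by
    have hre : 0 < ((b : ℂ) + y * Complex.I).re := by simpa using hb0
    have hnsq : ‖(b : ℂ) + y * Complex.I‖ ^ 2 = b ^ 2 + 1 := by
      rw [← Complex.normSq_eq_norm_sq, Complex.normSq_apply]; simp; nlinarith
    have hn1 : 1 ≤ ‖(b : ℂ) + y * Complex.I‖ := by
      nlinarith [norm_nonneg ((b : ℂ) + y * Complex.I), sq_nonneg b]
    rw [norm_gaussianProfile m X hre, hnsq]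
    have h1 : ‖(b : ℂ) + y * Complex.I‖⁻¹ ^ m ≤ 1 :=
      Real.rpow_le_one (by positivity) (inv_le_one_of_one_le₀ hn1) (by linarith)
    have h2 : Real.exp (-(X * (((b : ℂ) + y * Complex.I).re / (b ^ 2 + 1))))
        ≤ (X * (b / 2))⁻¹ := by
      refine (Real.exp_le_exp.2 ?_).trans (exp_neg_le_inv (by positivity))
      have : ((b : ℂ) + y * Complex.I).re = b := by simp
      rw [this, neg_le_neg_iff]
      gcongr
      nlinarith
    calc _ ≤ 1 * (X * (b / 2))⁻¹ := by gcongr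
      _ = 2 * b ^ (-1 : ℝ) / X := by rw [Real.rpow_neg_one]; field_simp
      _ ≤ _ := by
        gcongr 2 * ?_ / X
        exact Real.rpow_le_rpow_of_exponent_ge hb0 hb (by linarith)
  have hA := key 1 (by norm_num)
  have hB := key (-1) (by norm_num)
  have hC : ‖gaussianProfile m X b‖ ≤ b ^ (-m) / X := by
    have hre : 0 < (b : ℂ).re := by simpa using hb0
    rw [norm_gaussianProfile m X hre, Complex.ofReal_re, Complex.norm_real,
      Real.norm_of_nonneg hb0.le, Real.inv_rpow hb0.le, ← Real.rpow_neg hb0.le, div_eq_mul_inv]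
    refine mul_le_mul_of_nonneg_left ?_ (by positivity)
    refine (exp_neg_le_inv (by positivity)).trans (inv_anti₀ hX ?_)
    have : 1 ≤ b / b ^ 2 := by rw [le_div_iff₀ (by positivity)]; nlinarith
    exact le_mul_of_one_le_right hX.le this
  simp only [Complex.ofReal_one, one_mul, Complex.ofReal_neg, neg_mul, ← sub_eq_add_neg] at hA hB
  rw [profileSecondDiff]
  refine (norm_sub_le _ _).trans ((add_le_add_left (norm_sub_le _ _) _).trans ?_)
  rw [norm_mul, norm_mul]
  have h3 : ‖((1 / 2) : ℂ)‖ = 1 / 2 := by norm_num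
  rw [h3]
  calc _ ≤ b ^ (-m) / X + 1 / 2 * (2 * b ^ (-m) / X) + 1 / 2 * (2 * b ^ (-m) / X) := by gcongr
    _ = _ := by ring

/-! ### Boundedness and decay of the oscillatory transform -/

/-- The weight `cos (2π x·z) (1 - cos (π |z|²))`. -/
def oscWeight {n : ℕ} (x z : Rn n) : ℝ :=
  Real.cos (2 * Real.pi * inner ℝ x z) * (1 - Real.cos (Real.pi * ‖z‖ ^ 2))

theorem measurable_oscWeight {n : ℕ} (x : Rn n) : Measurable (oscWeight x) := by
  unfold oscWeight; fun_prop

theorem abs_oscWeight_le {n : ℕ} (x z : Rn n) : |oscWeight x z| ≤ 2 := by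
  rw [oscWeight, abs_mul]
  exact (mul_le_of_le_one_left (abs_nonneg _) (Real.abs_cos_le_one _)).trans (abs_one_sub_cos_le _)

theorem abs_oscWeight_le_sq {n : ℕ} (x z : Rn n) : |oscWeight x z| ≤ 2 * Real.pi * ‖z‖ ^ 2 := by
  rw [oscWeight, abs_mul]
  refine (mul_le_of_le_one_left (abs_nonneg _) (Real.abs_cos_le_one _)).trans
    ((abs_one_sub_cos_le_abs _).trans ?_)
  rw [abs_of_nonneg (by positivity)]
  linarith

/-- The Fourier transform of `(1 - cos (π |z|²)) |z|^{-n-2δ}`. -/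
def oscTransform (n : ℕ) (δ : ℝ) (x : Rn n) : ℝ := ∫ z, oscWeight x z * gagliardoKernel n δ z

/-- Writing cos(π|z|²) as the mean of e^{±iπ|z|²} shifts the variance by ±i, so the factor 1 -
cos(π|z|²) becomes a second difference. -/
theorem integral_oscWeight_mul_exp {n : ℕ} (x : Rn n) {b : ℝ} (hb : 0 < b) :
    ∫ z : Rn n, oscWeight x z * Real.exp (-(Real.pi * b * ‖z‖ ^ 2))
      = (profileSecondDiff (n / 2) (Real.pi * ‖x‖ ^ 2) b).re := by
  have h0 := integral_cos_mul_exp x hb 0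
  have h1 := integral_cos_mul_exp x hb 1
  have h2 := integral_cos_mul_exp x hb (-1)
  have i0 := integrable_cos_mul_exp x hb 0
  have i1 := integrable_cos_mul_exp x hb 1
  have i2 := integrable_cos_mul_exp x hb (-1)
  have h (z : Rn n) : oscWeight x z * Real.exp (-(Real.pi * b * ‖z‖ ^ 2))
      = Real.cos (2 * Real.pi * inner ℝ x z - Real.pi * 0 * ‖z‖ ^ 2) *
          Real.exp (-(Real.pi * b * ‖z‖ ^ 2))
        - (1 / 2) * (Real.cos (2 * Real.pi * inner ℝ x z - Real.pi * 1 * ‖z‖ ^ 2) *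
          Real.exp (-(Real.pi * b * ‖z‖ ^ 2)))
        - (1 / 2) * (Real.cos (2 * Real.pi * inner ℝ x z - Real.pi * (-1) * ‖z‖ ^ 2) *
          Real.exp (-(Real.pi * b * ‖z‖ ^ 2))) := by
    rw [oscWeight, Real.cos_sub _ (Real.pi * 1 * _),
      show Real.pi * (-1) * ‖z‖ ^ 2 = -(Real.pi * 1 * ‖z‖ ^ 2) by ring, sub_neg_eq_add,
      Real.cos_add]
    simp only [mul_one, mul_zero, zero_mul, sub_zero]
    ring
  simp_rw [h]
  have hE := integral_sub (i0.sub (i1.const_mul (1 / 2))) (i2.const_mul (1 / 2))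
  simp only [Pi.sub_apply] at hE
  rw [hE, integral_sub i0 (i1.const_mul _), integral_const_mul, integral_const_mul, h0, h1, h2, profileSecondDiff]
  have hhalf (w : ℂ) : (1 / 2 * w).re = 1 / 2 * w.re := by
    simp
  simp only [Complex.sub_re, hhalf, Complex.ofReal_zero, zero_mul, add_zero, Complex.ofReal_one,
    one_mul, Complex.ofReal_neg, neg_mul, ← sub_eq_add_neg]

/-- Boundedness is absolute integrability of (1 - cos(π|z|²))|z|^{-n-2δ}. The decay |x|^{-2} is the
factor 1/X of the second-difference bounds, with X = π|x|², integrated over the subordination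
parameter. -/
theorem exists_abs_oscTransform_le {n : ℕ} (hn : 2 ≤ n) {δ : ℝ} (hδ0 : 0 < δ) (hδ1 : δ < 1) :
    ∃ C : ℝ, 0 ≤ C ∧ ∀ x : Rn n,
      |oscTransform n δ x| ≤ C ∧ |oscTransform n δ x| * ‖x‖ ^ 2 ≤ C := by
  have hm : (1 : ℝ) ≤ n / 2 := by
    have : (2 : ℝ) ≤ n := by exact_mod_cast hn
    linarith
  have hc := gaussianMixConst_pos (n := n) hδ0
  -- The second-difference bounds times b^{n/2+δ-1}: the exponents n/2 cancel, leaving δ - 1 near 0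
  -- and δ - 2 near infinity.
  set bd : ℝ → ℝ := fun b => if b ≤ 1 then 3 * b ^ (δ - 1) else 400 * (n / 2 : ℝ) ^ 2 * b ^ (δ - 2)
    with hbd
  have hbdi : IntegrableOn bd (Set.Ioi 0) := by
    rw [← Set.Ioc_union_Ioi_eq_Ioi (zero_le_one (α := ℝ))]
    refine IntegrableOn.union ?_ ?_
    · have h1 : IntegrableOn (fun b : ℝ => 3 * b ^ (δ - 1)) (Set.Ioc 0 1) :=
        (intervalIntegrable_iff_integrableOn_Ioc_of_le zero_le_one).1
          ((intervalIntegral.intervalIntegrable_rpow' (by linarith)).const_mul 3)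
      refine h1.congr_fun (fun b hb => ?_) measurableSet_Ioc
      rw [hbd]; simp only; rw [if_pos hb.2]
    · have h1 : IntegrableOn (fun b : ℝ => 400 * (n / 2 : ℝ) ^ 2 * b ^ (δ - 2)) (Set.Ioi 1) :=
        (integrableOn_Ioi_rpow_of_lt (by linarith) one_pos).const_mul _
      refine h1.congr_fun (fun b hb => ?_) measurableSet_Ioi
      rw [hbd]; simp only; rw [if_neg (not_le.2 hb)]
  set C₁ := gaussianMixConst n δ * ∫ b in Set.Ioi (0 : ℝ), bd b with hC₁
  have hker : Integrable (fun z : Rn n => (1 - Real.cos (Real.pi * ‖z‖ ^ 2)) * gagliardoKernel n δ z) :=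
    integrable_mul_gagliardoKernel hn hδ0 hδ1 (by fun_prop) (fun _ => abs_one_sub_cos_le _)
      (C₂ := 2 * Real.pi) (fun z => (abs_one_sub_cos_le_abs _).trans (by
        rw [abs_of_nonneg (by positivity)]; linarith))
  set C₂ := ∫ z : Rn n, (1 - Real.cos (Real.pi * ‖z‖ ^ 2)) * gagliardoKernel n δ z with hC₂
  have hC1 : 0 ≤ C₁ := by
    refine mul_nonneg hc.le (setIntegral_nonneg measurableSet_Ioi fun b hb => ?_)
    have hb' : (0 : ℝ) < b := hb
    rw [hbd]; simp only; split_ifs <;> positivity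
  have hC2 : 0 ≤ C₂ := integral_nonneg fun z => mul_nonneg
    (by linarith [Real.cos_le_one (Real.pi * ‖z‖ ^ 2)]) (gagliardoKernel_nonneg δ z)
  refine ⟨C₁ + C₂, by positivity, fun x => ⟨?_, ?_⟩⟩
  · refine le_trans ?_ (le_add_of_nonneg_left hC1)
    rw [← Real.norm_eq_abs]
    refine norm_integral_le_of_norm_le hker (Eventually.of_forall fun z => ?_)
    rw [norm_mul, Real.norm_of_nonneg (gagliardoKernel_nonneg δ z), oscWeight, norm_mul]
    refine mul_le_mul_of_nonneg_right ?_ (gagliardoKernel_nonneg δ z)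
    rw [Real.norm_of_nonneg (r := 1 - _) (by linarith [Real.cos_le_one (Real.pi * ‖z‖ ^ 2)])]
    exact mul_le_of_le_one_left (by linarith [Real.cos_le_one (Real.pi * ‖z‖ ^ 2)])
      (Real.abs_cos_le_one _)
  · refine le_trans ?_ (le_add_of_nonneg_right hC2)
    rcases eq_or_ne x 0 with rfl | hx
    · simpa using hC1
    have hx' : 0 < ‖x‖ := norm_pos_iff.2 hx
    set X := Real.pi * ‖x‖ ^ 2 with hX
    have hX0 : 0 < X := by positivity
    have hle : |oscTransform n δ x| ≤ C₁ / X := by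
      rw [oscTransform, integral_mul_gagliardoKernel hn hδ0 hδ1 (measurable_oscWeight x)
        (abs_oscWeight_le x) (abs_oscWeight_le_sq x), abs_mul, abs_of_pos hc, hC₁, mul_div_assoc]
      refine mul_le_mul_of_nonneg_left ?_ hc.le
      rw [← integral_div, ← Real.norm_eq_abs]
      refine norm_integral_le_of_norm_le (hbdi.div_const X) ?_
      refine (ae_restrict_iff' measurableSet_Ioi).2 (Eventually.of_forall fun b hb => ?_)
      have hb' : (0 : ℝ) < b := hb
      rw [integral_oscWeight_mul_exp x hb', norm_mul, Real.norm_of_nonneg (by positivity)]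
      have hre := Complex.abs_re_le_norm (profileSecondDiff (n / 2) X b)
      rw [← Real.norm_eq_abs] at hre
      rw [hbd]
      simp only
      split_ifs with h1
      · have := hre.trans (norm_profileSecondDiff_le_of_le_one hm hX0 hb' h1)
        calc _ ≤ b ^ (n / 2 + δ - 1 : ℝ) * (3 * b ^ (-(n / 2) : ℝ) / X) := by gcongr
          _ = 3 * (b ^ (n / 2 + δ - 1 : ℝ) * b ^ (-(n / 2) : ℝ)) / X := by ring
          _ = _ := by rw [← Real.rpow_add hb']; ring_nf
      · have := hre.trans (norm_profileSecondDiff_le_of_one_le hm hX0 (not_le.1 h1).le)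
        calc _ ≤ b ^ (n / 2 + δ - 1 : ℝ) * (400 * (n / 2) ^ 2 * b ^ (-(n / 2) - 1 : ℝ) / X) := by
              gcongr
          _ = 400 * (n / 2 : ℝ) ^ 2 * (b ^ (n / 2 + δ - 1 : ℝ) * b ^ (-(n / 2) - 1 : ℝ)) / X := by ring
          _ = _ := by rw [← Real.rpow_add hb']; ring_nf
    calc _ ≤ C₁ / X * ‖x‖ ^ 2 := by gcongr
      _ = C₁ / Real.pi := by rw [hX]; field_simp
      _ ≤ C₁ := div_le_self hC1 (by linarith [Real.pi_gt_three])

theorem continuous_oscTransform {n : ℕ} (hn : 2 ≤ n) {δ : ℝ} (hδ0 : 0 < δ) (hδ1 : δ < 1) :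
    Continuous (oscTransform n δ) := by
  have hker : Integrable (fun z : Rn n => (1 - Real.cos (Real.pi * ‖z‖ ^ 2)) * gagliardoKernel n δ z) :=
    integrable_mul_gagliardoKernel hn hδ0 hδ1 (by fun_prop) (fun _ => abs_one_sub_cos_le _)
      (C₂ := 2 * Real.pi) (fun z => (abs_one_sub_cos_le_abs _).trans (by
        rw [abs_of_nonneg (by positivity)]; linarith))
  refine continuous_of_dominated (fun x => ?_) (fun x => ?_) hker.norm ?_
  · exact ((measurable_oscWeight x).mul (measurable_gagliardoKernel δ)).aestronglyMeasurable
  · refine Eventually.of_forall fun z => ?_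
    rw [norm_mul, norm_mul, oscWeight, norm_mul]
    exact mul_le_mul_of_nonneg_right
      (mul_le_of_le_one_left (norm_nonneg _) (Real.abs_cos_le_one _)) (norm_nonneg _)
  · refine Eventually.of_forall fun z => ?_
    unfold oscWeight
    fun_prop

/-! ### The correction to the symbol at time t -/

/-- The symbol correction `∫ cos (2π t ξ·z) (1 - cos (π t |z|²)) |z|^{-n-2δ} dz`, written by
scaling through `oscTransform`. -/
def oscCorrection (n : ℕ) (δ t : ℝ) (ξ : Rn n) : ℝ := |t| ^ δ * oscTransform n δ (√|t| • ξ)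

theorem integral_scaled_oscWeight {n : ℕ} {δ : ℝ} {t : ℝ} (ht : 0 < t) (ξ : Rn n) :
    ∫ z, oscWeight (√t • ξ) (√t • z) * gagliardoKernel n δ z = oscCorrection n δ t ξ := by
  have hs : 0 < √t := Real.sqrt_pos.2 ht
  have h := Measure.integral_comp_smul (volume : Measure (Rn n))
    (fun z => oscWeight (√t • ξ) z * gagliardoKernel n δ z) (√t)
  rw [finrank_euclideanSpace_fin, abs_of_pos (by positivity), smul_eq_mul] at h
  rw [oscCorrection, oscTransform, abs_of_pos ht]
  have h2 : ∀ z : Rn n, gagliardoKernel n δ (√t • z)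
      = √t ^ (-(n + 2 * δ) : ℝ) * gagliardoKernel n δ z := by
    intro z
    rw [gagliardoKernel, gagliardoKernel, norm_smul, Real.norm_of_nonneg hs.le,
      Real.mul_rpow hs.le (norm_nonneg _)]
  simp_rw [h2, mul_left_comm] at h
  rw [integral_const_mul] at h
  have h3 : √t ^ (-(n + 2 * δ) : ℝ) = (√t ^ n)⁻¹ * (t ^ δ)⁻¹ := by
    rw [neg_add, Real.rpow_add hs, Real.rpow_neg hs.le, Real.rpow_natCast, Real.rpow_neg hs.le,
      Real.rpow_mul hs.le, Real.rpow_two, Real.sq_sqrt ht.le]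
  rw [h3, mul_assoc] at h
  have h4 := mul_left_cancel₀ (by positivity) h
  rw [← h4, mul_inv_cancel_left₀ (by positivity)]

/-- The phase is α + β with α = 2πtξ·z odd and β = πt|z|² even in z. Then 1 - cos(α+β) = (1 - cos α)
+ cos α (1 - cos β) + sin α sin β: the first term gives the pure power, the second the correction,
and the third is odd and integrates to 0. -/
theorem integrable_phase_kernel {n : ℕ} (hn : 2 ≤ n) {δ : ℝ} (hδ0 : 0 < δ) (hδ1 : δ < 1)
    (t : ℝ) (ξ : Rn n) :
    Integrable (fun z => (1 - Real.cos (Real.pi * t * (‖ξ + z‖ ^ 2 - ‖ξ‖ ^ 2)))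
      * gagliardoKernel n δ z) ∧
    ∫ z, (1 - Real.cos (Real.pi * t * (‖ξ + z‖ ^ 2 - ‖ξ‖ ^ 2))) * gagliardoKernel n δ z
      = flatConst n δ * |t| ^ (2 * δ) * ‖ξ‖ ^ (2 * δ) + oscCorrection n δ t ξ := by
  wlog ht : 0 ≤ t generalizing t
  · have := this (-t) (by linarith)
    have h2 (s : ℝ) : Real.cos (Real.pi * (-t) * s) = Real.cos (Real.pi * t * s) := by
      rw [← Real.cos_neg]; ring_nf
    simpa only [h2, abs_neg, oscCorrection] using this
  rcases ht.eq_or_lt with rfl | ht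
  · simp [oscCorrection, Real.zero_rpow hδ0.ne', Real.zero_rpow (by positivity : 2 * δ ≠ 0)]
  have hs : √t ^ 2 = t := Real.sq_sqrt ht.le
  -- the odd part
  set S : Rn n → ℝ := fun z => Real.sin (2 * Real.pi * inner ℝ (t • ξ) z) *
    Real.sin (Real.pi * t * ‖z‖ ^ 2) with hS
  have hdecomp (z : Rn n) : 1 - Real.cos (Real.pi * t * (‖ξ + z‖ ^ 2 - ‖ξ‖ ^ 2))
      = (1 - Real.cos (2 * Real.pi * inner ℝ (t • ξ) z)) + oscWeight (√t • ξ) (√t • z) + S z := by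
    have h1 : Real.pi * t * (‖ξ + z‖ ^ 2 - ‖ξ‖ ^ 2)
        = 2 * Real.pi * inner ℝ (t • ξ) z + Real.pi * t * ‖z‖ ^ 2 := by
      rw [norm_add_sq_real, real_inner_smul_left]; ring
    have h2 : (inner ℝ (√t • ξ) (√t • z) : ℝ) = inner ℝ (t • ξ) z := by
      rw [real_inner_smul_left, real_inner_smul_left, real_inner_smul_right, ← mul_assoc, ← sq, hs]
    have h3 : ‖√t • z‖ ^ 2 = t * ‖z‖ ^ 2 := by
      rw [norm_smul, mul_pow, Real.norm_eq_abs, sq_abs, hs]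
    rw [h1, Real.cos_add, oscWeight, h2, h3, hS, ← mul_assoc Real.pi]
    ring
  have hSi : Integrable (fun z => S z * gagliardoKernel n δ z) := by
    refine integrable_mul_gagliardoKernel hn hδ0 hδ1 (by fun_prop) (C₁ := 1)
      (C₂ := Real.pi * t) (fun z => ?_) (fun z => ?_)
    · rw [hS, abs_mul]
      exact mul_le_one₀ (Real.abs_sin_le_one _) (abs_nonneg _) (Real.abs_sin_le_one _)
    · rw [hS, abs_mul]
      refine (mul_le_of_le_one_left (abs_nonneg _) (Real.abs_sin_le_one _)).trans ?_
      refine (Real.abs_sin_le_abs).trans ?_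
      rw [abs_of_nonneg (by positivity)]
  have hS0 : ∫ z, S z * gagliardoKernel n δ z = 0 := by
    have h := integral_neg_eq_self (fun z => S z * gagliardoKernel n δ z) volume
    have h2 : (fun z => S (-z) * gagliardoKernel n δ (-z))
        = fun z => -(S z * gagliardoKernel n δ z) := by
      ext z
      rw [gagliardoKernel_neg, hS]
      simp
    rw [h2, integral_neg] at h
    linarith
  have hAi := integrable_one_sub_cos_inner hn hδ0 hδ1 (t • ξ)
  have hBi : Integrable (fun z => oscWeight (√t • ξ) (√t • z) * gagliardoKernel n δ z) := by
    refine integrable_mul_gagliardoKernel hn hδ0 hδ1 ?_ (fun z => abs_oscWeight_le _ _)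
      (C₂ := 2 * Real.pi * t) (fun z => ?_)
    · exact (measurable_oscWeight _).comp (by fun_prop)
    · refine (abs_oscWeight_le_sq _ _).trans ?_
      rw [norm_smul, mul_pow, Real.norm_eq_abs, sq_abs, hs, mul_assoc]
      ring_nf; rfl
  simp_rw [hdecomp, add_mul]
  refine ⟨(hAi.add hBi).add hSi, ?_⟩
  have hE := integral_add (hAi.add hBi) hSi
  simp only [Pi.add_apply] at hE
  rw [hE, integral_add hAi hBi, hS0,
    integral_one_sub_cos_inner hn hδ0 hδ1, integral_scaled_oscWeight ht, norm_smul,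
    Real.norm_eq_abs, Real.mul_rpow (abs_nonneg _) (norm_nonneg _)]
  ring

/-- Domination and decay of the symbol correction. -/
theorem exists_abs_oscCorrection_le {n : ℕ} (hn : 2 ≤ n) {δ : ℝ} (hδ0 : 0 < δ) (hδ1 : δ < 1) :
    ∃ C : ℝ, 0 ≤ C ∧ ∀ (t : ℝ) (ξ : Rn n), |oscCorrection n δ t ξ| ≤ C * |t| ^ δ ∧
      |oscCorrection n δ t ξ| * ‖ξ‖ ^ 2 ≤ C * |t| ^ (δ - 1) ∧
      |oscCorrection n δ t ξ| * ‖ξ‖ ^ (2 * δ) ≤ C := by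
  obtain ⟨C, hC, h⟩ := exists_abs_oscTransform_le hn hδ0 hδ1
  refine ⟨C, hC, fun t ξ => ?_⟩
  have h1 : |oscCorrection n δ t ξ| ≤ C * |t| ^ δ := by
    rw [oscCorrection, abs_mul, abs_of_nonneg (a := |t| ^ δ) (by positivity), mul_comm]
    gcongr
    exact (h _).1
  rcases eq_or_ne t 0 with rfl | ht
  · have : oscCorrection n δ 0 ξ = 0 := by simp [oscCorrection, Real.zero_rpow hδ0.ne']
    rw [this]
    simp only [abs_zero, zero_mul]
    exact ⟨by positivity, by positivity, hC⟩
  have ht' : 0 < |t| := abs_pos.2 ht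
  have h2 : |oscCorrection n δ t ξ| * ‖ξ‖ ^ 2 ≤ C * |t| ^ (δ - 1) := by
    have h3 := (h (√|t| • ξ)).2
    rw [norm_smul, mul_pow, Real.norm_eq_abs, sq_abs, Real.sq_sqrt ht'.le] at h3
    rw [oscCorrection, abs_mul, abs_of_nonneg (a := |t| ^ δ) (by positivity),
      Real.rpow_sub_one ht'.ne']
    calc _ = (|oscTransform n δ (√|t| • ξ)| * (|t| * ‖ξ‖ ^ 2)) * (|t| ^ δ / |t|) := by
          field_simp
      _ ≤ _ := by gcongr
  refine ⟨h1, h2, ?_⟩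
  set R := |oscCorrection n δ t ξ|
  -- The crossover scale is |t||ξ|² = 1: the bound C|t|^δ is used below it, the decay in ξ above it.
  rcases le_or_gt (|t| * ‖ξ‖ ^ 2) 1 with hle | hgt
  · calc R * ‖ξ‖ ^ (2 * δ) ≤ C * |t| ^ δ * ‖ξ‖ ^ (2 * δ) := by gcongr
      _ = C * (|t| * ‖ξ‖ ^ 2) ^ δ := by
        rw [Real.mul_rpow ht'.le (by positivity), Real.rpow_mul (norm_nonneg _), Real.rpow_two]; ring
      _ ≤ C * 1 := by gcongr; exact Real.rpow_le_one (by positivity) hle hδ0.le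
      _ = C := mul_one C
  · have hξ : 0 < ‖ξ‖ := by
      rcases (norm_nonneg ξ).eq_or_lt with h0 | h0
      · rw [← h0] at hgt; norm_num at hgt
      · exact h0
    have hξ2 : ‖ξ‖ ^ (2 * δ) = ‖ξ‖ ^ 2 * (‖ξ‖ ^ 2) ^ (δ - 1) := by
      rw [Real.rpow_mul (norm_nonneg _), Real.rpow_two, Real.rpow_sub_one (by positivity)]
      field_simp
    calc R * ‖ξ‖ ^ (2 * δ) = R * ‖ξ‖ ^ 2 * (‖ξ‖ ^ 2) ^ (δ - 1) := by rw [hξ2]; ring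
      _ ≤ C * |t| ^ (δ - 1) * (‖ξ‖ ^ 2) ^ (δ - 1) := by gcongr
      _ = C * (|t| * ‖ξ‖ ^ 2) ^ (δ - 1) := by
        rw [Real.mul_rpow ht'.le (by positivity)]; ring
      _ ≤ C * 1 := by
        gcongr
        exact Real.rpow_le_one_of_one_le_of_nonpos hgt.le (by linarith)
      _ = C := mul_one C

theorem continuous_oscCorrection {n : ℕ} (hn : 2 ≤ n) {δ : ℝ} (hδ0 : 0 < δ) (hδ1 : δ < 1) :
    Continuous (fun p : ℝ × Rn n => oscCorrection n δ p.1 p.2) := by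
  have h := continuous_oscTransform hn hδ0 hδ1
  have h2 : Continuous (fun p : ℝ × Rn n => |p.1| ^ δ) :=
    (continuous_fst.abs).rpow_const fun _ => Or.inr hδ0.le
  exact h2.mul (h.comp (by fun_prop))

/-! ### Translations, modulations and Plancherel in L² -/

theorem eLpNorm_two_sq {n : ℕ} (f : Rn n → ℂ) :
    eLpNorm f 2 volume ^ 2 = ∫⁻ x, ‖f x‖ₑ ^ 2 := by
  have := eLpNorm_nnreal_pow_eq_lintegral (f := f) (μ := (volume : Measure (Rn n)))
    (p := 2) two_ne_zero
  simpa using this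

theorem enorm_L2_sq {n : ℕ} (g : L2Rn n) : ‖g‖ₑ ^ 2 = ∫⁻ x, ‖g x‖ₑ ^ 2 := by
  rw [Lp.enorm_def, eLpNorm_two_sq]

/-- The character `x ↦ e^{-2πi x·z}`. -/
def character {n : ℕ} (z x : Rn n) : ℂ :=
  Complex.exp (((-(2 * Real.pi * inner ℝ x z) : ℝ) : ℂ) * Complex.I)

theorem continuous_character {n : ℕ} (z : Rn n) : Continuous (character z) := by
  unfold character
  fun_prop

theorem norm_character {n : ℕ} (z x : Rn n) : ‖character z x‖ = 1 :=
  Complex.norm_exp_ofReal_mul_I _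

theorem norm_exp_mul_I_sub_one_sq (a : ℝ) :
    ‖Complex.exp ((a : ℂ) * Complex.I) - 1‖ ^ 2 = 2 * (1 - Real.cos a) := by
  rw [← Complex.normSq_eq_norm_sq, Complex.normSq_apply, Complex.sub_re, Complex.sub_im,
    Complex.exp_ofReal_mul_I_re, Complex.exp_ofReal_mul_I_im, Complex.one_re, Complex.one_im]
  nlinarith [Real.sin_sq_add_cos_sq a]

theorem norm_character_sub_one_sq {n : ℕ} (z x : Rn n) :
    ‖character z x - 1‖ ^ 2 = 2 * (1 - Real.cos (2 * Real.pi * inner ℝ x z)) := by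
  rw [character, norm_exp_mul_I_sub_one_sq, Real.cos_neg]

theorem memLp_character_mul {n : ℕ} (z : Rn n) (g : L2Rn n) :
    MemLp (fun x => character z x * g x) 2 volume := by
  refine (Lp.memLp g).of_le
    ((continuous_character z).aestronglyMeasurable.mul (Lp.aestronglyMeasurable g))
    (Eventually.of_forall fun x => ?_)
  rw [norm_mul, norm_character, one_mul]

/-- Multiplication by the character `e^{-2πi x·z}` on `L²`. -/
def modulateL2 {n : ℕ} (z : Rn n) (g : L2Rn n) : L2Rn n := (memLp_character_mul z g).toLp

theorem coeFn_modulateL2 {n : ℕ} (z : Rn n) (g : L2Rn n) :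
    modulateL2 z g =ᵐ[volume] fun x => character z x * g x := MemLp.coeFn_toLp _

theorem isometry_modulateL2 {n : ℕ} (z : Rn n) : Isometry (modulateL2 z : L2Rn n → L2Rn n) := by
  refine Isometry.of_dist_eq fun g₁ g₂ => ?_
  rw [dist_eq_norm, dist_eq_norm, Lp.norm_def, Lp.norm_def]
  congr 1
  refine eLpNorm_congr_norm_ae ?_
  filter_upwards [coeFn_modulateL2 z g₁, coeFn_modulateL2 z g₂, Lp.coeFn_sub (modulateL2 z g₁) (modulateL2 z g₂),
    Lp.coeFn_sub g₁ g₂] with x h1 h2 h3 h4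
  rw [h3, h4, Pi.sub_apply, Pi.sub_apply, h1, h2, ← mul_sub, norm_mul, norm_character, one_mul]

/-- Translation `g ↦ g(· + z)` on `L²`. -/
def translateL2 {n : ℕ} (z : Rn n) (g : L2Rn n) : L2Rn n :=
  Lp.compMeasurePreserving (fun η => η + z) (measurePreserving_add_right volume z) g

theorem coeFn_translateL2 {n : ℕ} (z : Rn n) (g : L2Rn n) :
    translateL2 z g =ᵐ[volume] fun η => g (η + z) :=
  Lp.coeFn_compMeasurePreserving g (measurePreserving_add_right volume z)

/-- Both sides are continuous in g, so Schwartz functions suffice; there it is translation of the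
variable in the inversion integral. -/
theorem fourierInv_translateL2 {n : ℕ} (z : Rn n) (g : L2Rn n) :
    (𝓕⁻ (translateL2 z g) : L2Rn n) = modulateL2 z (𝓕⁻ g : L2Rn n) := by
  refine DenseRange.induction_on
    (p := fun g : L2Rn n => (𝓕⁻ (translateL2 z g) : L2Rn n) = modulateL2 z (𝓕⁻ g : L2Rn n))
    (SchwartzMap.denseRange_toLpCLM (E := Rn n) (F := ℂ) (p := 2) (μ := volume)
      ENNReal.ofNat_ne_top) g ?_ ?_
  · refine isClosed_eq ?_ ?_
    · exact continuous_fourierInv.comp (Lp.isometry_compMeasurePreserving _).continuous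
    · exact (isometry_modulateL2 z).continuous.comp continuous_fourierInv
  · intro φ
    rw [SchwartzMap.toLpCLM_apply]
    set ψ : 𝓢(Rn n, ℂ) := φ.compSubConstCLM ℂ (-z) with hψ
    have hψv (η : Rn n) : ψ η = φ (η + z) := by
      rw [hψ, SchwartzMap.compSubConstCLM_apply, sub_neg_eq_add]
    have h1 : translateL2 z (φ.toLp 2) = ψ.toLp 2 := by
      refine Lp.ext ?_
      have hq := (measurePreserving_add_right (volume : Measure (Rn n)) z).quasiMeasurePreserving
      filter_upwards [coeFn_translateL2 z (φ.toLp 2), ψ.coeFn_toLp 2 volume,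
        hq.ae (φ.coeFn_toLp 2 volume)] with η h1 h2 h3
      rw [h1, h2, h3, hψv]
    rw [h1, SchwartzMap.toLp_fourierInv_eq, SchwartzMap.toLp_fourierInv_eq]
    refine Lp.ext ?_
    filter_upwards [coeFn_modulateL2 z ((𝓕⁻ φ).toLp 2), (𝓕⁻ ψ).coeFn_toLp 2 volume,
      (𝓕⁻ φ).coeFn_toLp 2 volume] with x h1 h2 h3
    rw [h1, h2, h3, SchwartzMap.fourierInv_coe, SchwartzMap.fourierInv_coe, Real.fourierInv_eq',
      Real.fourierInv_eq', ← integral_const_mul]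
    have h4 := integral_add_right_eq_self (μ := (volume : Measure (Rn n)))
      (fun v : Rn n => character z x *
        (Complex.exp (((2 * Real.pi * inner ℝ v x : ℝ) : ℂ) * Complex.I) • φ v)) z
    rw [← h4]
    congr 1
    ext v
    rw [hψv, character, smul_eq_mul, smul_eq_mul, ← mul_assoc, ← Complex.exp_add, ← add_mul,
      ← Complex.ofReal_add]
    congr 4
    rw [inner_add_left, real_inner_comm x z]
    ring

/-- Plancherel turns a translation difference of the transform into multiplication of v by the
character minus 1. -/
theorem lintegral_translate_sub_sq {n : ℕ} (z : Rn n) (v : L2Rn n) :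
    ∫⁻ η, ‖(𝓕 v : L2Rn n) (η + z) - (𝓕 v : L2Rn n) η‖ₑ ^ 2
      = ∫⁻ x, ENNReal.ofReal (2 * (1 - Real.cos (2 * Real.pi * inner ℝ x z))) * ‖v x‖ₑ ^ 2 := by
  set g : L2Rn n := 𝓕 v with hg
  have hv : (𝓕⁻ g : L2Rn n) = v := FourierTransform.fourierInv_fourier_eq v
  have h1 : ‖translateL2 z g - g‖ₑ = ‖modulateL2 z v - v‖ₑ := by
    have h3 : modulateL2 z v - v = (𝓕⁻ (translateL2 z g - g) : L2Rn n) := by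
      rw [← hv, ← fourierInv_translateL2, sub_eq_add_neg, sub_eq_add_neg,
        FourierTransform.fourierInv_add, FourierTransform.fourierInv_neg]
    have h4 := Lp.norm_fourier_eq (𝓕⁻ (translateL2 z g - g) : L2Rn n)
    rw [FourierTransform.fourier_fourierInv_eq] at h4
    rw [h3, ← ofReal_norm, ← ofReal_norm, h4]
  have h2 : ∫⁻ η, ‖g (η + z) - g η‖ₑ ^ 2 = ‖translateL2 z g - g‖ₑ ^ 2 := by
    rw [enorm_L2_sq]
    refine lintegral_congr_ae ?_
    filter_upwards [coeFn_translateL2 z g, Lp.coeFn_sub (translateL2 z g) g] with η h1 h2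
    rw [h2, Pi.sub_apply, h1]
  rw [h2, h1, enorm_L2_sq]
  refine lintegral_congr_ae ?_
  filter_upwards [coeFn_modulateL2 z v, Lp.coeFn_sub (modulateL2 z v) v] with x h1 h2
  rw [h2, Pi.sub_apply, h1, ← sub_one_mul, enorm_mul, mul_pow]
  congr 1
  rw [← norm_character_sub_one_sq, ← ofReal_norm, ENNReal.ofReal_pow (norm_nonneg _)]

/-! ### The Gagliardo energy as a weighted L² norm -/

/-- The Gagliardo energy `∬ |g(η+z) - g(η)|² |z|^{-n-2δ} dη dz`. -/
def gagliardoEnergy {n : ℕ} (δ : ℝ) (g : Rn n → ℂ) : ENNReal :=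
  ∫⁻ z, ∫⁻ η, ‖g (η + z) - g η‖ₑ ^ 2 * ENNReal.ofReal (gagliardoKernel n δ z)

theorem gagliardoEnergy_congr_ae {n : ℕ} (δ : ℝ) {g₁ g₂ : Rn n → ℂ} (h : g₁ =ᵐ[volume] g₂) :
    gagliardoEnergy δ g₁ = gagliardoEnergy δ g₂ := by
  refine lintegral_congr fun z => lintegral_congr_ae ?_
  have hq := (measurePreserving_add_right (volume : Measure (Rn n)) z).quasiMeasurePreserving
  filter_upwards [h, hq.ae h] with η h1 h2
  rw [h1, h2]

/-- Plancherel for each shift z, then Tonelli: the z-integral produces κ|x|^{2δ}. The identity lives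
in [0, ∞], so it also decides finiteness. -/
theorem gagliardoEnergy_fourier {n : ℕ} (hn : 2 ≤ n) {δ : ℝ} (hδ0 : 0 < δ) (hδ1 : δ < 1)
    (v : L2Rn n) :
    gagliardoEnergy δ (𝓕 v : L2Rn n)
      = ∫⁻ x, ENNReal.ofReal (2 * flatConst n δ * ‖x‖ ^ (2 * δ)) * ‖v x‖ₑ ^ 2 := by
  have hv : Measurable v := (Lp.stronglyMeasurable v).measurable
  have hg : Measurable (𝓕 v : L2Rn n) := (Lp.stronglyMeasurable _).measurable
  have h1 (z : Rn n) : ∫⁻ η, ‖(𝓕 v : L2Rn n) (η + z) - (𝓕 v : L2Rn n) η‖ₑ ^ 2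
        * ENNReal.ofReal (gagliardoKernel n δ z)
      = ∫⁻ x, ENNReal.ofReal (2 * (1 - Real.cos (2 * Real.pi * inner ℝ x z))) * ‖v x‖ₑ ^ 2
        * ENNReal.ofReal (gagliardoKernel n δ z) := by
    rw [lintegral_mul_const _ (by fun_prop), lintegral_mul_const _ (by fun_prop),
      lintegral_translate_sub_sq]
  rw [gagliardoEnergy]
  simp_rw [h1]
  rw [lintegral_lintegral_swap (by fun_prop)]
  refine lintegral_congr fun x => ?_
  have h2 (z : Rn n) : ENNReal.ofReal (2 * (1 - Real.cos (2 * Real.pi * inner ℝ x z))) * ‖v x‖ₑ ^ 2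
        * ENNReal.ofReal (gagliardoKernel n δ z)
      = ENNReal.ofReal ((1 - Real.cos (2 * Real.pi * inner ℝ x z)) * gagliardoKernel n δ z)
        * (2 * ‖v x‖ₑ ^ 2) := by
    rw [ENNReal.ofReal_mul zero_le_two, ENNReal.ofReal_mul
      (by linarith [Real.cos_le_one (2 * Real.pi * inner ℝ x z)])]
    simp only [ENNReal.ofReal_ofNat]
    ring
  simp_rw [h2]
  rw [lintegral_mul_const _ (by fun_prop), ← ofReal_integral_eq_lintegral_ofReal
    (integrable_one_sub_cos_inner hn hδ0 hδ1 x) (Eventually.of_forall fun z => mul_nonneg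
      (by linarith [Real.cos_le_one (2 * Real.pi * inner ℝ x z)]) (gagliardoKernel_nonneg δ z)),
    integral_one_sub_cos_inner hn hδ0 hδ1, mul_assoc 2, ENNReal.ofReal_mul zero_le_two]
  simp only [ENNReal.ofReal_ofNat]
  ring

/-! ### The fractional Hardy inequality -/

theorem gagliardoEnergy_eq_symm {n : ℕ} (δ : ℝ) {g : Rn n → ℂ} (hg : Measurable g) :
    gagliardoEnergy δ g
      = ∫⁻ η, ∫⁻ ξ, ‖g ξ - g η‖ₑ ^ 2 * ENNReal.ofReal (gagliardoKernel n δ (ξ - η)) := by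
  rw [gagliardoEnergy, lintegral_lintegral_swap (by fun_prop)]
  refine lintegral_congr fun η => ?_
  rw [← lintegral_sub_right_eq_self (fun z => ‖g (η + z) - g η‖ₑ ^ 2
    * ENNReal.ofReal (gagliardoKernel n δ z)) η]
  simp

theorem enorm_sq_le_two_mul (a b : ℂ) : ‖a‖ₑ ^ 2 ≤ 2 * ‖b‖ₑ ^ 2 + 2 * ‖a - b‖ₑ ^ 2 := by
  have h : ‖a‖ ^ 2 ≤ 2 * ‖b‖ ^ 2 + 2 * ‖a - b‖ ^ 2 := by
    have h1 : ‖a‖ ≤ ‖b‖ + ‖a - b‖ := by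
      have := norm_add_le b (a - b)
      rwa [add_sub_cancel] at this
    nlinarith [norm_nonneg a, norm_nonneg b, norm_nonneg (a - b), sq_nonneg (‖b‖ - ‖a - b‖)]
  simp only [← ofReal_norm, ← ENNReal.ofReal_pow (norm_nonneg _)]
  rw [← ENNReal.ofReal_ofNat, ← ENNReal.ofReal_mul (by norm_num), ← ENNReal.ofReal_mul (by norm_num),
    ← ENNReal.ofReal_add (by positivity) (by positivity)]
  exact ENNReal.ofReal_le_ofReal h

/-- The indicator of the annular region `τ < |ξ|`, `a|ξ| < |η| < 2a|ξ|`, weighted by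
`|ξ|^{-n-2δ}`. -/
def annularKernel (n : ℕ) (δ τ a : ℝ) (p : Rn n × Rn n) : ENNReal :=
  Set.indicator {p : Rn n × Rn n | τ < ‖p.1‖ ∧ a * ‖p.1‖ < ‖p.2‖ ∧ ‖p.2‖ < 2 * a * ‖p.1‖}
    (fun p => ENNReal.ofReal (‖p.1‖ ^ (-(n + 2 * δ) : ℝ))) p

theorem measurable_annularKernel (n : ℕ) (δ τ a : ℝ) : Measurable (annularKernel n δ τ a) := by
  unfold annularKernel
  have h1 : MeasurableSet {p : Rn n × Rn n | τ < ‖p.1‖} :=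
    measurableSet_lt (by fun_prop) (by fun_prop)
  have h2 : MeasurableSet {p : Rn n × Rn n | a * ‖p.1‖ < ‖p.2‖} :=
    measurableSet_lt (by fun_prop) (by fun_prop)
  have h3 : MeasurableSet {p : Rn n × Rn n | ‖p.2‖ < 2 * a * ‖p.1‖} :=
    measurableSet_lt (by fun_prop) (by fun_prop)
  exact Measurable.indicator (by fun_prop) (h1.inter (h2.inter h3))

/-- The truncated Hardy weight `1_{|ξ| > τ} |ξ|^{-2δ}`. -/
def truncWeight {n : ℕ} (δ τ : ℝ) (ξ : Rn n) : ENNReal :=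
  Set.indicator {ξ : Rn n | τ < ‖ξ‖} (fun ξ => ENNReal.ofReal (‖ξ‖ ^ (-(2 * δ)))) ξ

theorem measurable_truncWeight {n : ℕ} (δ τ : ℝ) : Measurable (truncWeight (n := n) δ τ) := by
  unfold truncWeight
  exact Measurable.indicator (by fun_prop) (measurableSet_lt (by fun_prop) (by fun_prop))

/-- The shell of radii r and 2r, r = a|ξ|, has volume at least rⁿ|B| since 2ⁿ - 1 ≥ 1; rⁿ|ξ|^{-n-2δ}
is aⁿ|ξ|^{-2δ}. -/
theorem le_lintegral_annularKernel {n : ℕ} (hn : 2 ≤ n) {δ τ a : ℝ} (hτ : 0 < τ)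
    (ha : 1 < a) (ξ : Rn n) :
    ENNReal.ofReal (a ^ n) * volume (Metric.ball (0 : Rn n) 1) * truncWeight δ τ ξ
      ≤ ∫⁻ η, annularKernel n δ τ a (ξ, η) := by
  by_cases hξ : τ < ‖ξ‖
  swap
  · simp [truncWeight, Set.indicator_of_notMem (show ξ ∉ {ξ : Rn n | τ < ‖ξ‖} from hξ)]
  have hξ0 : 0 < ‖ξ‖ := hτ.trans hξ
  have hnt : Nontrivial (Rn n) := by
    apply Module.nontrivial_of_finrank_pos (R := ℝ)
    rw [finrank_euclideanSpace_fin]; omega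
  set r := a * ‖ξ‖ with hr
  have hr0 : 0 < r := by positivity
  set A : Set (Rn n) := Metric.ball 0 (2 * r) \ Metric.closedBall 0 r with hA
  have hAm : MeasurableSet A := measurableSet_ball.diff measurableSet_closedBall
  have h1 (η : Rn n) : annularKernel n δ τ a (ξ, η)
      = A.indicator (fun _ => ENNReal.ofReal (‖ξ‖ ^ (-(n + 2 * δ) : ℝ))) η := by
    rw [annularKernel]
    by_cases hη : η ∈ A
    · rw [Set.indicator_of_mem hη, Set.indicator_of_mem]
      simp only [hA, Set.mem_sdiff, mem_ball_zero_iff, mem_closedBall_zero_iff, not_le] at hη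
      exact ⟨hξ, hη.2, by rw [mul_assoc]; exact hη.1⟩
    · rw [Set.indicator_of_notMem hη, Set.indicator_of_notMem]
      rintro ⟨_, h2, h3⟩
      apply hη
      simp only [hA, Set.mem_sdiff, mem_ball_zero_iff, mem_closedBall_zero_iff, not_le]
      exact ⟨by rw [mul_assoc] at h3; exact h3, h2⟩
  have hvol : ENNReal.ofReal (r ^ n) * volume (Metric.ball (0 : Rn n) 1) ≤ volume A := by
    have h2 := le_measure_sdiff (μ := (volume : Measure (Rn n))) (s₁ := Metric.ball (0 : Rn n) (2 * r))
      (s₂ := Metric.closedBall 0 r)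
    rw [Measure.addHaar_closedBall _ _ hr0.le, Measure.addHaar_ball _ _ (by positivity),
      finrank_euclideanSpace_fin] at h2
    refine le_trans ?_ h2
    have hfin : ENNReal.ofReal (r ^ n) * volume (Metric.ball (0 : Rn n) 1) ≠ ⊤ :=
      ENNReal.mul_ne_top ENNReal.ofReal_ne_top measure_ball_lt_top.ne
    refine ENNReal.le_sub_of_add_le_right hfin ?_
    rw [← add_mul, ← ENNReal.ofReal_add (by positivity) (by positivity)]
    gcongr
    rw [mul_pow 2 r n]
    have : (2 : ℝ) ≤ 2 ^ n := by
      calc (2 : ℝ) = 2 ^ 1 := by norm_num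
        _ ≤ 2 ^ n := pow_le_pow_right₀ (by norm_num) (by omega)
    nlinarith [pow_pos hr0 n]
  simp_rw [h1]
  rw [lintegral_indicator_const hAm, truncWeight,
    Set.indicator_of_mem (show ξ ∈ {ξ : Rn n | τ < ‖ξ‖} from hξ)]
  calc _ = ENNReal.ofReal (‖ξ‖ ^ (-(n + 2 * δ) : ℝ)) *
        (ENNReal.ofReal (r ^ n) * volume (Metric.ball (0 : Rn n) 1)) := by
        rw [← mul_assoc, mul_right_comm, ← ENNReal.ofReal_mul (by positivity),
          ← ENNReal.ofReal_mul (by positivity)]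
        congr 2
        rw [hr, mul_pow, neg_add, Real.rpow_add hξ0, Real.rpow_neg hξ0.le, Real.rpow_neg hξ0.le, Real.rpow_natCast]
        field_simp
    _ ≤ _ := by gcongr

/-- For fixed η, |ξ| lies between |η|/(2a) and |η|/a: a ball of volume of order a^{-n}|η|ⁿ with
weight at most (|η|/(2a))^{-n-2δ}. Hence the power a^{2δ}, against aⁿ for the integral in η. -/
theorem lintegral_annularKernel_le {n : ℕ} (hn : 2 ≤ n) {δ τ a : ℝ} (hδ0 : 0 < δ) (hτ : 0 < τ)
    (ha : 1 < a) (η : Rn n) :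
    ∫⁻ ξ, annularKernel n δ τ a (ξ, η)
      ≤ ENNReal.ofReal (2 ^ (n + 2 * δ) * a ^ (2 * δ)) * volume (Metric.ball (0 : Rn n) 1)
        * truncWeight δ τ η := by
  have hnt : Nontrivial (Rn n) := by
    apply Module.nontrivial_of_finrank_pos (R := ℝ)
    rw [finrank_euclideanSpace_fin]; omega
  have ha0 : 0 < a := by linarith
  by_cases hη : τ < ‖η‖
  swap
  · have h0 (ξ : Rn n) : annularKernel n δ τ a (ξ, η) = 0 := by
      rw [annularKernel, Set.indicator_of_notMem]
      rintro ⟨h1, h2, -⟩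
      simp only at h1 h2
      apply hη
      nlinarith
    simp [h0]
  have hη0 : 0 < ‖η‖ := hτ.trans hη
  set c := ‖η‖ / (2 * a) with hc
  have hc0 : 0 < c := by positivity
  have h1 (ξ : Rn n) : annularKernel n δ τ a (ξ, η)
      ≤ (Metric.ball (0 : Rn n) (‖η‖ / a)).indicator
        (fun _ => ENNReal.ofReal (c ^ (-(n + 2 * δ) : ℝ))) ξ := by
    rw [annularKernel]
    by_cases h : (ξ, η) ∈ {p : Rn n × Rn n |
        τ < ‖p.1‖ ∧ a * ‖p.1‖ < ‖p.2‖ ∧ ‖p.2‖ < 2 * a * ‖p.1‖}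
    · rw [Set.indicator_of_mem h, Set.indicator_of_mem]
      · apply ENNReal.ofReal_le_ofReal
        refine Real.rpow_le_rpow_of_nonpos hc0 ?_ ?_
        · rw [hc, div_le_iff₀ (by positivity)]
          linarith [h.2.2]
        · have : (0 : ℝ) ≤ n := Nat.cast_nonneg n
          linarith
      · rw [mem_ball_zero_iff, lt_div_iff₀ ha0]
        linarith [h.2.1]
    · rw [Set.indicator_of_notMem h]; exact zero_le
  refine (lintegral_mono h1).trans ?_
  rw [lintegral_indicator_const measurableSet_ball, Measure.addHaar_ball _ _ (by positivity),
    finrank_euclideanSpace_fin, truncWeight,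
    Set.indicator_of_mem (show η ∈ {ξ : Rn n | τ < ‖ξ‖} from hη), ← mul_assoc,
    mul_right_comm (ENNReal.ofReal (2 ^ _ * _)),
    ← ENNReal.ofReal_mul (by positivity), ← ENNReal.ofReal_mul (by positivity)]
  refine mul_le_mul_left (ENNReal.ofReal_le_ofReal (le_of_eq ?_)) _
  rw [hc, Real.div_rpow hη0.le (by positivity), Real.mul_rpow zero_le_two ha0.le, div_pow,
    Real.rpow_neg hη0.le, Real.rpow_neg ha0.le, Real.rpow_neg hη0.le, Real.rpow_neg zero_le_two,
    Real.rpow_add hη0, Real.rpow_add ha0, Real.rpow_natCast, Real.rpow_natCast]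
  field_simp

theorem annularKernel_le {n : ℕ} {δ τ a : ℝ} (hδ0 : 0 < δ) (hτ : 0 < τ) (ha : 1 < a) (ξ η : Rn n) :
    annularKernel n δ τ a (ξ, η)
      ≤ ENNReal.ofReal ((3 * a) ^ (n + 2 * δ : ℝ)) * ENNReal.ofReal (gagliardoKernel n δ (ξ - η)) := by
  have ha0 : 0 < a := by linarith
  rw [annularKernel]
  by_cases h : (ξ, η) ∈ {p : Rn n × Rn n |
        τ < ‖p.1‖ ∧ a * ‖p.1‖ < ‖p.2‖ ∧ ‖p.2‖ < 2 * a * ‖p.1‖}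
  swap
  · rw [Set.indicator_of_notMem h]; exact zero_le
  rw [Set.indicator_of_mem h, ← ENNReal.ofReal_mul (by positivity)]
  obtain ⟨h1, h2, h3⟩ := h
  simp only at h1 h2 h3 ⊢
  have hξ0 : 0 < ‖ξ‖ := hτ.trans h1
  have hd0 : 0 < ‖ξ - η‖ := by
    rw [norm_pos_iff, sub_ne_zero]
    rintro rfl
    nlinarith
  apply ENNReal.ofReal_le_ofReal
  rw [gagliardoKernel, show (3 * a) ^ (n + 2 * δ : ℝ) = ((3 * a)⁻¹) ^ (-(n + 2 * δ) : ℝ) by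
    rw [Real.inv_rpow (by positivity), Real.rpow_neg (by positivity), inv_inv],
    ← Real.mul_rpow (by positivity) (by positivity)]
  refine Real.rpow_le_rpow_of_nonpos (by positivity) ?_ ?_
  · rw [inv_mul_le_iff₀ (by positivity)]
    have := norm_sub_le ξ η
    nlinarith
  · have : (0 : ℝ) ≤ n := Nat.cast_nonneg n
    linarith

/-- Averaging |g(ξ)|² ≤ 2|g(η)|² + 2|g(ξ)-g(η)|² over far shells bounds the Hardy integral J by
itself plus the energy: 4PJ ≤ 2PJ + 2DE. The factor 4 is available for large a because 2δ < n, and C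
does not depend on τ. -/
theorem lintegral_truncWeight_le {n : ℕ} (hn : 2 ≤ n) {δ : ℝ} (hδ0 : 0 < δ) (hδ1 : δ < 1) :
    ∃ C : ENNReal, C ≠ ⊤ ∧ ∀ τ : ℝ, 0 < τ → ∀ g : Rn n → ℂ, Measurable g →
      ∫⁻ ξ, ‖g ξ‖ₑ ^ 2 ≠ ⊤ → ∫⁻ ξ, truncWeight δ τ ξ * ‖g ξ‖ₑ ^ 2 ≤ C * gagliardoEnergy δ g := by
  have hnr : (2 : ℝ) ≤ n := by exact_mod_cast hn
  -- choice of the dilation factor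
  obtain ⟨a, ha1, ha⟩ : ∃ a : ℝ, 1 < a ∧
      4 * (2 ^ (n + 2 * δ : ℝ) * a ^ (2 * δ)) ≤ a ^ n := by
    have ht : Tendsto (fun a : ℝ => a ^ (n - 2 * δ : ℝ)) atTop atTop :=
      tendsto_rpow_atTop (by linarith)
    obtain ⟨a, h1, h2⟩ := ((ht.eventually_ge_atTop (4 * 2 ^ (n + 2 * δ : ℝ))).and
      (eventually_gt_atTop 1)).exists
    refine ⟨a, h2, ?_⟩
    have ha0 : 0 < a := by linarith
    calc _ = 4 * 2 ^ (n + 2 * δ : ℝ) * a ^ (2 * δ) := by ring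
      _ ≤ a ^ (n - 2 * δ : ℝ) * a ^ (2 * δ) := by gcongr
      _ = a ^ n := by rw [← Real.rpow_add ha0, sub_add_cancel, Real.rpow_natCast]
  have ha0 : 0 < a := by linarith
  set ν : ENNReal := volume (Metric.ball (0 : Rn n) 1) with hν
  have hν0 : ν ≠ 0 := (Metric.measure_ball_pos volume (0 : Rn n) one_pos).ne'
  have hνt : ν ≠ ⊤ := measure_ball_lt_top.ne
  set P : ENNReal := ENNReal.ofReal (2 ^ (n + 2 * δ : ℝ) * a ^ (2 * δ)) * ν with hP
  have hP0 : P ≠ 0 := mul_ne_zero (by rw [ne_eq, ENNReal.ofReal_eq_zero, not_le]; positivity) hν0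
  have hPt : P ≠ ⊤ := ENNReal.mul_ne_top ENNReal.ofReal_ne_top hνt
  set D : ENNReal := ENNReal.ofReal ((3 * a) ^ (n + 2 * δ : ℝ)) with hD
  refine ⟨P⁻¹ * D, ENNReal.mul_ne_top (ENNReal.inv_ne_top.2 hP0) ENNReal.ofReal_ne_top, ?_⟩
  intro τ hτ g hg hgfin
  set J := ∫⁻ ξ, truncWeight δ τ ξ * ‖g ξ‖ₑ ^ 2 with hJ
  -- The truncation at τ is there for this: J must be finite before it can be absorbed into the left
  -- side.
  have hJt : J ≠ ⊤ := by
    have hle : J ≤ ENNReal.ofReal (τ ^ (-(2 * δ))) * ∫⁻ ξ, ‖g ξ‖ₑ ^ 2 := by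
      rw [← lintegral_const_mul _ (by fun_prop)]
      refine lintegral_mono fun ξ => ?_
      refine mul_le_mul_left ?_ _
      rw [truncWeight]
      by_cases h : ξ ∈ {ξ : Rn n | τ < ‖ξ‖}
      · rw [Set.indicator_of_mem h]
        exact ENNReal.ofReal_le_ofReal (Real.rpow_le_rpow_of_nonpos hτ (le_of_lt h) (by linarith))
      · rw [Set.indicator_of_notMem h]; exact zero_le
    exact ne_top_of_le_ne_top (ENNReal.mul_ne_top ENNReal.ofReal_ne_top hgfin) hle
  have hkm := measurable_annularKernel n δ τ a
  have htm := measurable_truncWeight (n := n) δ τ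
  have hL : 4 * P * J ≤ ∫⁻ ξ, ∫⁻ η, annularKernel n δ τ a (ξ, η) * ‖g ξ‖ₑ ^ 2 := by
    rw [hJ, ← lintegral_const_mul _ (by fun_prop)]
    refine lintegral_mono fun ξ => ?_
    rw [lintegral_mul_const _ (by fun_prop), ← mul_assoc]
    refine mul_le_mul_left (le_trans ?_ (le_lintegral_annularKernel hn hτ ha1 ξ)) _
    refine mul_le_mul_left ?_ _
    rw [hP, ← mul_assoc]
    refine mul_le_mul_left ?_ _
    rw [← ENNReal.ofReal_ofNat, ← ENNReal.ofReal_mul (by norm_num)]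
    exact ENNReal.ofReal_le_ofReal ha
  have hA : ∫⁻ ξ, ∫⁻ η, annularKernel n δ τ a (ξ, η) * ‖g η‖ₑ ^ 2 ≤ P * J := by
    rw [lintegral_lintegral_swap (by fun_prop), hJ, ← lintegral_const_mul _ (by fun_prop)]
    refine lintegral_mono fun η => ?_
    rw [lintegral_mul_const _ (by fun_prop), ← mul_assoc]
    exact mul_le_mul_left (lintegral_annularKernel_le hn hδ0 hτ ha1 η) _
  have hB : ∫⁻ ξ, ∫⁻ η, annularKernel n δ τ a (ξ, η) * ‖g ξ - g η‖ₑ ^ 2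
      ≤ D * gagliardoEnergy δ g := by
    rw [gagliardoEnergy_eq_symm δ hg, lintegral_lintegral_swap (by fun_prop),
      ← lintegral_const_mul _ (by fun_prop)]
    refine lintegral_mono fun η => ?_
    rw [← lintegral_const_mul _ (by fun_prop)]
    refine lintegral_mono fun ξ => ?_
    rw [mul_left_comm, mul_comm]
    exact mul_le_mul_right (annularKernel_le hδ0 hτ ha1 ξ η) _
  have hsum : 4 * P * J ≤ 2 * (P * J) + 2 * (D * gagliardoEnergy δ g) := by
    refine hL.trans (le_trans ?_ (add_le_add (mul_le_mul_right hA 2) (mul_le_mul_right hB 2)))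
    rw [← lintegral_const_mul _ (by fun_prop), ← lintegral_const_mul _ (by fun_prop),
      ← lintegral_add_left (by fun_prop)]
    refine lintegral_mono fun ξ => ?_
    rw [← lintegral_const_mul _ (by fun_prop), ← lintegral_const_mul _ (by fun_prop),
      ← lintegral_add_left (by fun_prop)]
    refine lintegral_mono fun η => ?_
    calc _ ≤ annularKernel n δ τ a (ξ, η) * (2 * ‖g η‖ₑ ^ 2 + 2 * ‖g ξ - g η‖ₑ ^ 2) :=
          mul_le_mul_right (enorm_sq_le_two_mul _ _) _
      _ = _ := by ring
  have hPJ : P * J ≠ ⊤ := ENNReal.mul_ne_top hPt hJt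
  have h2 : 2 * (P * J) ≤ 2 * (D * gagliardoEnergy δ g) := by
    have h3 : 2 * (P * J) + 2 * (P * J) ≤ 2 * (P * J) + 2 * (D * gagliardoEnergy δ g) := by
      refine le_trans (le_of_eq ?_) hsum
      ring
    exact (ENNReal.add_le_add_iff_left (ENNReal.mul_ne_top ENNReal.ofNat_ne_top hPJ)).1 h3
  have h4 : P * J ≤ D * gagliardoEnergy δ g :=
    (ENNReal.mul_le_mul_iff_right two_ne_zero ENNReal.ofNat_ne_top).1 h2
  calc J = P⁻¹ * (P * J) := by rw [← mul_assoc, ENNReal.inv_mul_cancel hP0 hPt, one_mul]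
    _ ≤ P⁻¹ * (D * gagliardoEnergy δ g) := mul_le_mul_right h4 _
    _ = _ := by rw [mul_assoc]

/-- Fractional Hardy inequality, in qualitative form. -/
theorem lintegral_hardy_ne_top {n : ℕ} (hn : 2 ≤ n) {δ : ℝ} (hδ0 : 0 < δ) (hδ1 : δ < 1)
    {g : Rn n → ℂ} (hg : Measurable g) (hg2 : ∫⁻ ξ, ‖g ξ‖ₑ ^ 2 ≠ ⊤) (hE : gagliardoEnergy δ g ≠ ⊤) :
    ∫⁻ ξ, ENNReal.ofReal (‖ξ‖ ^ (-(2 * δ))) * ‖g ξ‖ₑ ^ 2 ≠ ⊤ := by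
  obtain ⟨C, hC, h⟩ := lintegral_truncWeight_le hn hδ0 hδ1
  refine ne_top_of_le_ne_top (ENNReal.mul_ne_top hC hE) ?_
  -- The truncations at τ = 1/(k+1) increase to the full weight; at ξ = 0 the weight is 0 by the
  -- convention for `rpow`.
  have hsup (ξ : Rn n) : ENNReal.ofReal (‖ξ‖ ^ (-(2 * δ))) * ‖g ξ‖ₑ ^ 2
      ≤ ⨆ k : ℕ, truncWeight δ (1 / ((k : ℝ) + 1)) ξ * ‖g ξ‖ₑ ^ 2 := by
    rcases (norm_nonneg ξ).eq_or_lt with h0 | h0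
    · rw [← h0, Real.zero_rpow (by linarith)]; simp
    · obtain ⟨k, hk⟩ := exists_nat_one_div_lt h0
      refine le_iSup_of_le k ?_
      rw [truncWeight, Set.indicator_of_mem (show ξ ∈ {ξ : Rn n | _ < ‖ξ‖} from hk)]
  refine (lintegral_mono hsup).trans ?_
  rw [lintegral_iSup]
  · exact iSup_le fun k => h _ (by positivity) g hg hg2
  · intro k
    exact (measurable_truncWeight δ _).mul (by fun_prop)
  · intro k l hkl ξ
    refine mul_le_mul_left ?_ _
    refine Set.indicator_le_indicator_of_subset ?_ (fun _ => zero_le) ξ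
    intro x hx
    have : 1 / ((l : ℝ) + 1) ≤ 1 / ((k : ℝ) + 1) := Nat.one_div_le_one_div hkl
    exact lt_of_le_of_lt this hx

/-! ### Weighted norms and the flow on the Fourier side -/

theorem enorm_powWeight_sq {n : ℕ} (s : ℝ) (g : L2Rn n) (x : Rn n) :
    ‖powWeight s g x‖ₑ ^ 2 = ENNReal.ofReal (‖x‖ ^ (2 * s)) * ‖g x‖ₑ ^ 2 := by
  rw [powWeight, enorm_mul, mul_pow]
  congr 1
  rw [← ofReal_norm, Complex.norm_real, Real.norm_of_nonneg (by positivity),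
    ← ENNReal.ofReal_pow (by positivity), mul_comm 2 s, Real.rpow_mul (norm_nonneg _),
    Real.rpow_two]

theorem measurable_L2 {n : ℕ} (g : L2Rn n) : Measurable g := (Lp.stronglyMeasurable g).measurable

theorem memLp_powWeight_iff {n : ℕ} (s : ℝ) (g : L2Rn n) :
    MemLp (powWeight s g) 2 volume ↔
      ∫⁻ x, ENNReal.ofReal (‖x‖ ^ (2 * s)) * ‖g x‖ₑ ^ 2 ≠ ⊤ := by
  have hm : Measurable (powWeight s g) := by
    have := measurable_L2 g
    unfold powWeight
    fun_prop
  simp_rw [← enorm_powWeight_sq]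
  rw [← eLpNorm_two_sq, ← lt_top_iff_ne_top, ENNReal.pow_lt_top_iff]
  simp [MemLp, hm.aestronglyMeasurable]

theorem weightedNorm_sq {n : ℕ} (s : ℝ) (g : L2Rn n) :
    weightedNorm s g ^ 2 = (∫⁻ x, ENNReal.ofReal (‖x‖ ^ (2 * s)) * ‖g x‖ₑ ^ 2).toReal := by
  simp_rw [← enorm_powWeight_sq]
  rw [← eLpNorm_two_sq, ENNReal.toReal_pow, weightedNorm]

theorem lintegral_L2_ne_top {n : ℕ} (g : L2Rn n) : ∫⁻ x, ‖g x‖ₑ ^ 2 ≠ ⊤ := by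
  rw [← enorm_L2_sq]
  exact ENNReal.pow_ne_top enorm_ne_top

theorem fourier_schrodingerFlow_ae {n : ℕ} (f : L2Rn n) (t : ℝ) :
    (𝓕 (schrodingerFlow f t) : L2Rn n)
      =ᵐ[volume] fun ξ => schrodingerSymbol t ξ * (𝓕 f : L2Rn n) ξ := by
  rw [schrodingerFlow, FourierTransform.fourier_fourierInv_eq]
  exact MemLp.coeFn_toLp _

theorem norm_schrodingerSymbol {n : ℕ} (t : ℝ) (ξ : Rn n) : ‖schrodingerSymbol t ξ‖ = 1 :=
  Complex.norm_exp_ofReal_mul_I _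

theorem measurable_schrodingerSymbol {n : ℕ} :
    Measurable (fun p : ℝ × Rn n => schrodingerSymbol p.1 p.2) := by
  unfold schrodingerSymbol
  fun_prop

/-! ### Even part in time of the Gagliardo energy of the flow -/

/-- The phase `π t (|η+z|² - |η|²)`. -/
def phase {n : ℕ} (t : ℝ) (z η : Rn n) : ℝ := Real.pi * t * (‖η + z‖ ^ 2 - ‖η‖ ^ 2)

@[fun_prop]
theorem Measurable.phase {n : ℕ} {α : Type*} [MeasurableSpace α] {t : α → ℝ} {z η : α → Rn n}
    (ht : Measurable t) (hz : Measurable z) (hη : Measurable η) :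
    Measurable (fun a => phase (t a) (z a) (η a)) := by
  unfold _root_.phase
  fun_prop

theorem schrodingerSymbol_add {n : ℕ} (t : ℝ) (z η : Rn n) :
    schrodingerSymbol t (η + z)
      = Complex.exp (((-phase t z η : ℝ) : ℂ) * Complex.I) * schrodingerSymbol t η := by
  rw [schrodingerSymbol, schrodingerSymbol, ← Complex.exp_add, phase]
  congr 1
  push_cast
  ring

theorem norm_symbol_mul_sub_sq {n : ℕ} (t : ℝ) (z η : Rn n) (a b : ℂ) :
    ‖schrodingerSymbol t (η + z) * a - schrodingerSymbol t η * b‖ ^ 2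
      = ‖a‖ ^ 2 + ‖b‖ ^ 2 - 2 * (Real.cos (phase t z η) * (a.re * b.re + a.im * b.im)
        + Real.sin (phase t z η) * (a.im * b.re - a.re * b.im)) := by
  have h1 : schrodingerSymbol t (η + z) * a - schrodingerSymbol t η * b
      = schrodingerSymbol t η * (Complex.exp (((-phase t z η : ℝ) : ℂ) * Complex.I) * a - b) := by
    rw [schrodingerSymbol_add]; ring
  rw [h1, norm_mul, norm_schrodingerSymbol, one_mul]
  simp only [← Complex.normSq_eq_norm_sq, Complex.normSq_apply, Complex.sub_re, Complex.sub_im,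
    Complex.mul_re, Complex.mul_im, Complex.exp_ofReal_mul_I_re, Complex.exp_ofReal_mul_I_im,
    Real.cos_neg, Real.sin_neg]
  linear_combination (a.re ^ 2 + a.im ^ 2) * Real.sin_sq_add_cos_sq (phase t z η)

/-- The sine terms at t and -t cancel. The term (1 - cos θ)|a - b|² stands on the left so that every
summand is nonnegative and the identity transfers to [0, ∞]. -/
theorem norm_symbol_mul_sub_sq_even {n : ℕ} (t : ℝ) (z η : Rn n) (a b : ℂ) :
    ‖schrodingerSymbol t (η + z) * a - schrodingerSymbol t η * b‖ ^ 2
      + ‖schrodingerSymbol (-t) (η + z) * a - schrodingerSymbol (-t) η * b‖ ^ 2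
      + 2 * ((1 - Real.cos (phase t z η)) * ‖a - b‖ ^ 2)
      = 2 * ‖a - b‖ ^ 2 + 2 * ((1 - Real.cos (phase t z η)) * ‖a‖ ^ 2)
        + 2 * ((1 - Real.cos (phase t z η)) * ‖b‖ ^ 2) := by
  have h : phase (-t) z η = -phase t z η := by unfold phase; ring
  rw [norm_symbol_mul_sub_sq, norm_symbol_mul_sub_sq, h, Real.cos_neg, Real.sin_neg]
  simp only [← Complex.normSq_eq_norm_sq, Complex.normSq_apply, Complex.sub_re, Complex.sub_im]
  ring

theorem one_sub_cos_nonneg (a : ℝ) : 0 ≤ 1 - Real.cos a := by linarith [Real.cos_le_one a]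

theorem enorm_sq_eq_ofReal (a : ℂ) : ‖a‖ₑ ^ 2 = ENNReal.ofReal (‖a‖ ^ 2) := by
  rw [← ofReal_norm, ENNReal.ofReal_pow (norm_nonneg _)]

theorem enorm_symbol_mul_sub_sq_even {n : ℕ} (t : ℝ) (z η : Rn n) (a b : ℂ) :
    ‖schrodingerSymbol t (η + z) * a - schrodingerSymbol t η * b‖ₑ ^ 2
      + ‖schrodingerSymbol (-t) (η + z) * a - schrodingerSymbol (-t) η * b‖ₑ ^ 2
      + 2 * (ENNReal.ofReal (1 - Real.cos (phase t z η)) * ‖a - b‖ₑ ^ 2)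
      = 2 * ‖a - b‖ₑ ^ 2 + 2 * (ENNReal.ofReal (1 - Real.cos (phase t z η)) * ‖a‖ₑ ^ 2)
        + 2 * (ENNReal.ofReal (1 - Real.cos (phase t z η)) * ‖b‖ₑ ^ 2) := by
  have h := norm_symbol_mul_sub_sq_even t z η a b
  have hc := one_sub_cos_nonneg (phase t z η)
  simp only [enorm_sq_eq_ofReal, ← ENNReal.ofReal_mul hc]
  have h2 (x : ℝ) : (2 : ENNReal) * ENNReal.ofReal x = ENNReal.ofReal (2 * x) := by
    rw [ENNReal.ofReal_mul zero_le_two, ENNReal.ofReal_ofNat]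
  simp only [h2]
  rw [← ENNReal.ofReal_add (by positivity) (by positivity),
    ← ENNReal.ofReal_add (by positivity) (by positivity),
    ← ENNReal.ofReal_add (by positivity) (by positivity),
    ← ENNReal.ofReal_add (by positivity) (by positivity), h]

/-- The measure `|g(η+z) - g(η)|² |z|^{-n-2δ} dz dη`. -/
def gagliardoMeasure {n : ℕ} (δ : ℝ) (g : Rn n → ℂ) : Measure (Rn n × Rn n) :=
  (volume.prod volume).withDensity
    fun p => ‖g (p.2 + p.1) - g p.2‖ₑ ^ 2 * ENNReal.ofReal (gagliardoKernel n δ p.1)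

theorem lintegral_gagliardoMeasure {n : ℕ} (δ : ℝ) {g : Rn n → ℂ} (hg : Measurable g)
    {F : Rn n × Rn n → ENNReal} (hF : Measurable F) :
    ∫⁻ p, F p ∂(gagliardoMeasure δ g) = ∫⁻ z, ∫⁻ η, F (z, η) *
      (‖g (η + z) - g η‖ₑ ^ 2 * ENNReal.ofReal (gagliardoKernel n δ z)) := by
  rw [gagliardoMeasure, lintegral_withDensity_eq_lintegral_mul _ (by fun_prop) hF,
    lintegral_prod _ (by fun_prop)]
  simp only [Pi.mul_apply, mul_comm (F _)]

theorem gagliardoMeasure_univ {n : ℕ} (δ : ℝ) {g : Rn n → ℂ} (hg : Measurable g) :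
    gagliardoMeasure δ g Set.univ = gagliardoEnergy δ g := by
  rw [← lintegral_one, lintegral_gagliardoMeasure δ hg measurable_const]
  simp only [one_mul, gagliardoEnergy]

/-- The energy `∬ (1 - cos θ) |g(η)|² |z|^{-n-2δ} dη dz` of the phase defect. -/
def phaseEnergy {n : ℕ} (δ t : ℝ) (g : Rn n → ℂ) : ENNReal :=
  ∫⁻ z, ∫⁻ η, ENNReal.ofReal (1 - Real.cos (phase t z η)) * ‖g η‖ₑ ^ 2
    * ENNReal.ofReal (gagliardoKernel n δ z)

/-- The change of variables (z, η) → (-z, η + z) exchanges g(η+z) with g(η) and only flips the sign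
of the phase. -/
theorem phaseEnergy_shift {n : ℕ} (δ t : ℝ) {g : Rn n → ℂ} :
    ∫⁻ z, ∫⁻ η, ENNReal.ofReal (1 - Real.cos (phase t z η)) * ‖g (η + z)‖ₑ ^ 2
      * ENNReal.ofReal (gagliardoKernel n δ z) = phaseEnergy δ t g := by
  rw [phaseEnergy, ← lintegral_neg_eq_self]
  refine lintegral_congr fun z => ?_
  rw [← lintegral_add_right_eq_self _ z]
  refine lintegral_congr fun η => ?_
  rw [add_neg_cancel_right, gagliardoKernel_neg]
  congr 4
  rw [← Real.cos_neg]
  congr 1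
  simp only [phase, add_neg_cancel_right]
  ring

theorem phaseEnergy_eq {n : ℕ} (hn : 2 ≤ n) {δ : ℝ} (hδ0 : 0 < δ) (hδ1 : δ < 1) (t : ℝ)
    {g : Rn n → ℂ} (hg : Measurable g) :
    phaseEnergy δ t g = ∫⁻ η, ENNReal.ofReal
      (flatConst n δ * |t| ^ (2 * δ) * ‖η‖ ^ (2 * δ) + oscCorrection n δ t η) * ‖g η‖ₑ ^ 2 := by
  rw [phaseEnergy, lintegral_lintegral_swap (by fun_prop)]
  refine lintegral_congr fun η => ?_
  obtain ⟨hi, he⟩ := integrable_phase_kernel hn hδ0 hδ1 t η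
  have h2 (z : Rn n) : ENNReal.ofReal (1 - Real.cos (phase t z η)) * ‖g η‖ₑ ^ 2
      * ENNReal.ofReal (gagliardoKernel n δ z)
      = ENNReal.ofReal ((1 - Real.cos (phase t z η)) * gagliardoKernel n δ z) * ‖g η‖ₑ ^ 2 := by
    rw [ENNReal.ofReal_mul (one_sub_cos_nonneg _)]; ring
  simp_rw [h2]
  rw [lintegral_mul_const _ (by fun_prop), ← he, ofReal_integral_eq_lintegral_ofReal hi
    (Eventually.of_forall fun z => mul_nonneg (one_sub_cos_nonneg _) (gagliardoKernel_nonneg δ z))]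
  rfl

theorem gagliardoEnergy_even {n : ℕ} (δ t : ℝ) {g : Rn n → ℂ} (hg : Measurable g) :
    gagliardoEnergy δ (fun ξ => schrodingerSymbol t ξ * g ξ)
      + gagliardoEnergy δ (fun ξ => schrodingerSymbol (-t) ξ * g ξ)
      + 2 * ∫⁻ p, ENNReal.ofReal (1 - Real.cos (phase t p.1 p.2)) ∂(gagliardoMeasure δ g)
      = 2 * gagliardoEnergy δ g + 4 * phaseEnergy δ t g := by
  have hs := measurable_schrodingerSymbol (n := n)
  have hst (s : ℝ) : Measurable (schrodingerSymbol s : Rn n → ℂ) :=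
    hs.comp (measurable_const.prodMk measurable_id)
  have h1 := hst t
  have h2 := hst (-t)
  have h4 : 4 * phaseEnergy δ t g = 2 * (∫⁻ z, ∫⁻ η, ENNReal.ofReal (1 - Real.cos (phase t z η))
      * ‖g (η + z)‖ₑ ^ 2 * ENNReal.ofReal (gagliardoKernel n δ z)) + 2 * phaseEnergy δ t g := by
    rw [phaseEnergy_shift]; ring
  rw [h4, lintegral_gagliardoMeasure δ hg (by fun_prop), phaseEnergy]
  unfold gagliardoEnergy
  have hc (F : Rn n → Rn n → ENNReal) :
      2 * ∫⁻ z, ∫⁻ η, F z η = ∫⁻ z, ∫⁻ η, 2 * F z η := by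
    rw [← lintegral_const_mul' _ _ ENNReal.ofNat_ne_top]
    exact lintegral_congr fun z => (lintegral_const_mul' _ _ ENNReal.ofNat_ne_top).symm
  simp only [hc]
  rw [← lintegral_add_left (by fun_prop), ← lintegral_add_left (by fun_prop),
    ← lintegral_add_left (by fun_prop), ← lintegral_add_left (by fun_prop)]
  refine lintegral_congr fun z => ?_
  rw [← lintegral_add_left (by fun_prop), ← lintegral_add_left (by fun_prop),
    ← lintegral_add_left (by fun_prop), ← lintegral_add_left (by fun_prop)]
  refine lintegral_congr fun η => ?_
  have h := congrArg (· * ENNReal.ofReal (gagliardoKernel n δ z))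
    (enorm_symbol_mul_sub_sq_even t z η (g (η + z)) (g η))
  calc _ = _ := by ring
    _ = _ := h
    _ = _ := by ring

/-- Dropping nonnegative terms from the even identity gives finiteness at every time before anything
is subtracted. -/
theorem gagliardoEnergy_symbol_le {n : ℕ} (δ t : ℝ) {g : Rn n → ℂ} (hg : Measurable g) :
    gagliardoEnergy δ (fun ξ => schrodingerSymbol t ξ * g ξ)
      ≤ 2 * gagliardoEnergy δ g + 4 * phaseEnergy δ t g := by
  rw [← gagliardoEnergy_even δ t hg, add_assoc]
  exact le_self_add

theorem measurable_gagliardoEnergy_symbol {n : ℕ} (δ : ℝ) {g : Rn n → ℂ} (hg : Measurable g) :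
    Measurable (fun t => gagliardoEnergy δ (fun ξ => schrodingerSymbol t ξ * g ξ)) := by
  have hs := measurable_schrodingerSymbol (n := n)
  unfold gagliardoEnergy
  refine Measurable.lintegral_prod_right' (f := fun q : ℝ × Rn n => ∫⁻ η,
    ‖schrodingerSymbol q.1 (η + q.2) * g (η + q.2) - schrodingerSymbol q.1 η * g η‖ₑ ^ 2
      * ENNReal.ofReal (gagliardoKernel n δ q.2)) ?_
  refine Measurable.lintegral_prod_right' (f := fun r : (ℝ × Rn n) × Rn n =>
    ‖schrodingerSymbol r.1.1 (r.2 + r.1.2) * g (r.2 + r.1.2) - schrodingerSymbol r.1.1 r.2 * g r.2‖ₑ ^ 2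
      * ENNReal.ofReal (gagliardoKernel n δ r.1.2)) ?_
  have h1 : Measurable (fun r : (ℝ × Rn n) × Rn n => schrodingerSymbol r.1.1 (r.2 + r.1.2)) :=
    hs.comp (f := fun r : (ℝ × Rn n) × Rn n => (r.1.1, r.2 + r.1.2)) (by fun_prop)
  have h2 : Measurable (fun r : (ℝ × Rn n) × Rn n => schrodingerSymbol r.1.1 r.2) :=
    hs.comp (f := fun r : (ℝ × Rn n) × Rn n => (r.1.1, r.2)) (by fun_prop)
  fun_prop

theorem oscCorrection_add_nonneg {n : ℕ} (hn : 2 ≤ n) {δ : ℝ} (hδ0 : 0 < δ) (hδ1 : δ < 1)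
    (t : ℝ) (η : Rn n) :
    0 ≤ flatConst n δ * |t| ^ (2 * δ) * ‖η‖ ^ (2 * δ) + oscCorrection n δ t η := by
  rw [← (integrable_phase_kernel hn hδ0 hδ1 t η).2]
  exact integral_nonneg fun z => mul_nonneg (one_sub_cos_nonneg _) (gagliardoKernel_nonneg δ z)

theorem gagliardoEnergy_ne_top {n : ℕ} (hn : 2 ≤ n) {δ : ℝ} (hδ0 : 0 < δ) (hδ1 : δ < 1)
    {f : L2Rn n} (hf : MemSigma δ f) : gagliardoEnergy δ (𝓕 f : L2Rn n) ≠ ⊤ := by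
  have hm := measurable_L2 f
  have h := (memLp_powWeight_iff δ f).1 hf.1
  have hk := flatConst_pos hn hδ0 hδ1
  rw [gagliardoEnergy_fourier hn hδ0 hδ1]
  have h2 (x : Rn n) : ENNReal.ofReal (2 * flatConst n δ * ‖x‖ ^ (2 * δ)) * ‖f x‖ₑ ^ 2
      = ENNReal.ofReal (2 * flatConst n δ) * (ENNReal.ofReal (‖x‖ ^ (2 * δ)) * ‖f x‖ₑ ^ 2) := by
    rw [ENNReal.ofReal_mul (by positivity), mul_assoc]
  simp_rw [h2]
  rw [lintegral_const_mul _ (by fun_prop)]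
  exact ENNReal.mul_ne_top ENNReal.ofReal_ne_top h

theorem phaseEnergy_le {n : ℕ} (hn : 2 ≤ n) {δ : ℝ} (hδ0 : 0 < δ) (hδ1 : δ < 1) :
    ∃ C : ℝ, 0 ≤ C ∧ ∀ (t : ℝ) (g : Rn n → ℂ), Measurable g →
      phaseEnergy δ t g ≤ ENNReal.ofReal (C * (1 + |t|) ^ 2) *
        ((∫⁻ ξ, ENNReal.ofReal (‖ξ‖ ^ (2 * δ)) * ‖g ξ‖ₑ ^ 2) + ∫⁻ ξ, ‖g ξ‖ₑ ^ 2) := by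
  obtain ⟨C, hC, h⟩ := exists_abs_oscCorrection_le hn hδ0 hδ1
  have hk := flatConst_pos hn hδ0 hδ1
  refine ⟨flatConst n δ + C, by positivity, fun t g hg => ?_⟩
  rw [phaseEnergy_eq hn hδ0 hδ1 t hg, ← lintegral_add_left (by fun_prop),
    ← lintegral_const_mul _ (by fun_prop)]
  refine lintegral_mono fun η => ?_
  rw [← add_one_mul, ← mul_assoc, ← ENNReal.ofReal_one, ← ENNReal.ofReal_add (by positivity)
    (by norm_num), ← ENNReal.ofReal_mul (by positivity)]
  refine mul_le_mul_left (ENNReal.ofReal_le_ofReal ?_) _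
  have h1 : 1 ≤ 1 + |t| := by linarith [abs_nonneg t]
  have hp (s : ℝ) (hs0 : 0 ≤ s) (hs : s ≤ 2) : |t| ^ s ≤ (1 + |t|) ^ 2 := by
    calc |t| ^ s ≤ (1 + |t|) ^ s := Real.rpow_le_rpow (abs_nonneg _) (by linarith) hs0
      _ ≤ (1 + |t|) ^ (2 : ℝ) := Real.rpow_le_rpow_of_exponent_le h1 hs
      _ = _ := Real.rpow_two _
  have h2 := (le_abs_self _).trans (h t η).1
  calc _ ≤ flatConst n δ * (1 + |t|) ^ 2 * ‖η‖ ^ (2 * δ) + C * (1 + |t|) ^ 2 := by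
        gcongr
        · exact hp _ (by linarith) (by linarith)
        · exact h2.trans (by gcongr; exact hp _ (by linarith) (by linarith))
    _ ≤ _ := by
      have e1 : 0 ≤ flatConst n δ * (1 + |t|) ^ 2 := by positivity
      have e2 : 0 ≤ C * (1 + |t|) ^ 2 * ‖η‖ ^ (2 * δ) := by positivity
      nlinarith

/-! ### The dispersion functional: finiteness, growth, even part -/

section Dispersion

variable {n : ℕ} {δ : ℝ} {f : L2Rn n}

theorem exists_gagliardoEnergy_symbol_le (hn : 2 ≤ n) (hδ0 : 0 < δ) (hδ1 : δ < 1)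
    (hf : MemSigma δ f) : ∃ C : ℝ, 0 ≤ C ∧ ∀ t : ℝ,
      gagliardoEnergy δ (fun ξ => schrodingerSymbol t ξ * (𝓕 f : L2Rn n) ξ)
        ≤ ENNReal.ofReal (C * (1 + |t|) ^ 2) := by
  have hE := gagliardoEnergy_ne_top hn hδ0 hδ1 hf
  have hg := measurable_L2 (𝓕 f : L2Rn n)
  obtain ⟨C, hC, h⟩ := phaseEnergy_le hn hδ0 hδ1
  set S := (∫⁻ ξ, ENNReal.ofReal (‖ξ‖ ^ (2 * δ)) * ‖(𝓕 f : L2Rn n) ξ‖ₑ ^ 2)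
    + ∫⁻ ξ, ‖(𝓕 f : L2Rn n) ξ‖ₑ ^ 2 with hS
  have hSt : S ≠ ⊤ := ENNReal.add_ne_top.2
    ⟨(memLp_powWeight_iff δ _).1 hf.2, lintegral_L2_ne_top _⟩
  refine ⟨2 * (gagliardoEnergy δ (𝓕 f : L2Rn n)).toReal + 4 * (C * S.toReal), by positivity,
    fun t => ?_⟩
  refine (gagliardoEnergy_symbol_le δ t hg).trans ?_
  have h1 : (1 : ℝ) ≤ (1 + |t|) ^ 2 := one_le_pow₀ (by linarith [abs_nonneg t])
  calc _ ≤ 2 * gagliardoEnergy δ (𝓕 f : L2Rn n) + 4 * (ENNReal.ofReal (C * (1 + |t|) ^ 2) * S) := by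
        gcongr
        exact h t _ hg
    _ = ENNReal.ofReal (2 * (gagliardoEnergy δ (𝓕 f : L2Rn n)).toReal
        + 4 * (C * (1 + |t|) ^ 2 * S.toReal)) := by
      rw [ENNReal.ofReal_add (by positivity) (by positivity), ENNReal.ofReal_mul zero_le_two,
        ENNReal.ofReal_mul (zero_le_four (α := ℝ)),
        ENNReal.ofReal_mul (p := C * (1 + |t|) ^ 2) (q := S.toReal) (by positivity),
        ENNReal.ofReal_toReal hE, ENNReal.ofReal_toReal hSt]
      simp only [ENNReal.ofReal_ofNat]
    _ ≤ _ := by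
      apply ENNReal.ofReal_le_ofReal
      have : 0 ≤ (gagliardoEnergy δ (𝓕 f : L2Rn n)).toReal := ENNReal.toReal_nonneg
      nlinarith

theorem lintegral_dispersionDensity (hn : 2 ≤ n) (hδ0 : 0 < δ) (hδ1 : δ < 1) (f : L2Rn n) (t : ℝ) :
    ENNReal.ofReal (2 * flatConst n δ) * ∫⁻ x, ENNReal.ofReal (dispersionDensity δ f t x)
      = gagliardoEnergy δ (fun ξ => schrodingerSymbol t ξ * (𝓕 f : L2Rn n) ξ) := by
  have hu := measurable_L2 (schrodingerFlow f t)
  have hk := flatConst_pos hn hδ0 hδ1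
  rw [← gagliardoEnergy_congr_ae δ (fourier_schrodingerFlow_ae f t),
    gagliardoEnergy_fourier hn hδ0 hδ1, ← lintegral_const_mul' _ _ ENNReal.ofReal_ne_top]
  refine lintegral_congr fun x => ?_
  rw [dispersionDensity, enorm_sq_eq_ofReal, ← ENNReal.ofReal_mul (by positivity),
    ← ENNReal.ofReal_mul (by positivity), mul_assoc (2 * flatConst n δ)]

theorem dispersionDensity_nonneg (δ : ℝ) (f : L2Rn n) (t : ℝ) (x : Rn n) :
    0 ≤ dispersionDensity δ f t x := by
  unfold dispersionDensity; positivity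

theorem integrable_dispersionDensity (hn : 2 ≤ n) (hδ0 : 0 < δ) (hδ1 : δ < 1)
    (hf : MemSigma δ f) (t : ℝ) : Integrable (dispersionDensity δ f t) volume := by
  have hu := measurable_L2 (schrodingerFlow f t)
  have hk := flatConst_pos hn hδ0 hδ1
  have hm : Measurable (dispersionDensity δ f t) := by unfold dispersionDensity; fun_prop
  obtain ⟨C, hC, h⟩ := exists_gagliardoEnergy_symbol_le hn hδ0 hδ1 hf
  refine ⟨hm.aestronglyMeasurable, ?_⟩
  rw [hasFiniteIntegral_iff_ofReal (Eventually.of_forall (dispersionDensity_nonneg δ f t)),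
    lt_top_iff_ne_top]
  intro htop
  have h2 := lintegral_dispersionDensity hn hδ0 hδ1 f t
  rw [htop, ENNReal.mul_top (by rw [ne_eq, ENNReal.ofReal_eq_zero, not_le]; positivity)] at h2
  exact absurd (h t) (by rw [← h2]; simp)

theorem dispersion_eq (hn : 2 ≤ n) (hδ0 : 0 < δ) (hδ1 : δ < 1) (f : L2Rn n) (t : ℝ) :
    2 * flatConst n δ * dispersion δ f t
      = (gagliardoEnergy δ (fun ξ => schrodingerSymbol t ξ * (𝓕 f : L2Rn n) ξ)).toReal := by
  have hu := measurable_L2 (schrodingerFlow f t)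
  have hk := flatConst_pos hn hδ0 hδ1
  have hm : Measurable (dispersionDensity δ f t) := by unfold dispersionDensity; fun_prop
  rw [← lintegral_dispersionDensity hn hδ0 hδ1, ENNReal.toReal_mul,
    ENNReal.toReal_ofReal (by positivity), dispersion, integral_eq_lintegral_of_nonneg_ae
    (Eventually.of_forall (dispersionDensity_nonneg δ f t)) hm.aestronglyMeasurable]

theorem dispersion_nonneg (δ : ℝ) (f : L2Rn n) (t : ℝ) : 0 ≤ dispersion δ f t :=
  integral_nonneg (dispersionDensity_nonneg δ f t)

theorem measurable_dispersion (hn : 2 ≤ n) (hδ0 : 0 < δ) (hδ1 : δ < 1) (f : L2Rn n) :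
    Measurable (dispersion δ f) := by
  have hk := flatConst_pos hn hδ0 hδ1
  have h := (measurable_gagliardoEnergy_symbol δ (measurable_L2 (𝓕 f : L2Rn n))).ennreal_toReal
  have h2 : dispersion δ f = fun t => (2 * flatConst n δ)⁻¹ *
      (gagliardoEnergy δ (fun ξ => schrodingerSymbol t ξ * (𝓕 f : L2Rn n) ξ)).toReal := by
    ext t
    rw [← dispersion_eq hn hδ0 hδ1, inv_mul_cancel_left₀ (by positivity)]
  rw [h2]
  exact h.const_mul _

theorem exists_dispersion_le (hn : 2 ≤ n) (hδ0 : 0 < δ) (hδ1 : δ < 1) (hf : MemSigma δ f) :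
    ∃ C : ℝ, 0 ≤ C ∧ ∀ t, dispersion δ f t ≤ C * (1 + |t|) ^ 2 := by
  have hk := flatConst_pos hn hδ0 hδ1
  obtain ⟨C, hC, h⟩ := exists_gagliardoEnergy_symbol_le hn hδ0 hδ1 hf
  refine ⟨(2 * flatConst n δ)⁻¹ * C, by positivity, fun t => ?_⟩
  rw [mul_assoc, le_inv_mul_iff₀ (by positivity), dispersion_eq hn hδ0 hδ1]
  exact ENNReal.toReal_le_of_le_ofReal (by positivity) (h t)

theorem isFiniteMeasure_gagliardoMeasure (hn : 2 ≤ n) (hδ0 : 0 < δ) (hδ1 : δ < 1)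
    (hf : MemSigma δ f) : IsFiniteMeasure (gagliardoMeasure δ (𝓕 f : L2Rn n)) := by
  refine ⟨?_⟩
  rw [gagliardoMeasure_univ δ (measurable_L2 _)]
  exact (gagliardoEnergy_ne_top hn hδ0 hδ1 hf).lt_top

theorem integrable_weight_mul {s : ℝ} {g : L2Rn n}
    (h : ∫⁻ x, ENNReal.ofReal (‖x‖ ^ s) * ‖g x‖ₑ ^ 2 ≠ ⊤) :
    Integrable (fun x => ‖x‖ ^ s * ‖g x‖ ^ 2) := by
  have hg := measurable_L2 g
  refine ⟨by fun_prop, ?_⟩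
  rw [hasFiniteIntegral_iff_ofReal (Eventually.of_forall fun x => by positivity),
    lt_top_iff_ne_top]
  convert h using 4 with x
  rw [enorm_sq_eq_ofReal, ENNReal.ofReal_mul (by positivity)]

theorem integral_weight_mul (s : ℝ) (g : L2Rn n) :
    ∫ x, ‖x‖ ^ (2 * s) * ‖g x‖ ^ 2 = weightedNorm s g ^ 2 := by
  have hg := measurable_L2 g
  rw [weightedNorm_sq, integral_eq_lintegral_of_nonneg_ae
    (Eventually.of_forall fun x => by positivity) (by fun_prop)]
  congr 1
  refine lintegral_congr fun x => ?_
  rw [enorm_sq_eq_ofReal, ENNReal.ofReal_mul (by positivity)]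

theorem integrable_norm_sq_L2 (g : L2Rn n) : Integrable (fun x => ‖g x‖ ^ 2) := by
  have := integrable_weight_mul (s := 0) (g := g) (by simpa using lintegral_L2_ne_top g)
  simpa using this

theorem integrable_oscCorrection_mul (hn : 2 ≤ n) (hδ0 : 0 < δ) (hδ1 : δ < 1) (t : ℝ)
    (g : L2Rn n) : Integrable (fun η => oscCorrection n δ t η * ‖g η‖ ^ 2) := by
  have hg := measurable_L2 g
  obtain ⟨C, hC, h⟩ := exists_abs_oscCorrection_le hn hδ0 hδ1
  have hc : Measurable (oscCorrection n δ t) :=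
    ((continuous_oscCorrection hn hδ0 hδ1).comp (Continuous.prodMk_right t)).measurable
  refine ((integrable_norm_sq_L2 g).const_mul (C * |t| ^ δ)).mono' (by fun_prop)
    (Eventually.of_forall fun η => ?_)
  rw [norm_mul, Real.norm_eq_abs, Real.norm_of_nonneg (by positivity)]
  exact mul_le_mul_of_nonneg_right (h t η).1 (by positivity)

/-- The even part in time of the dispersion functional. -/
theorem dispersion_even_part (hn : 2 ≤ n) (hδ0 : 0 < δ) (hδ1 : δ < 1) (hf : MemSigma δ f) (t : ℝ) :
    (dispersion δ f t + dispersion δ f (-t)) / 2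
      = |t| ^ (2 * δ) * weightedNorm δ (𝓕 f : L2Rn n) ^ 2
        + (2 * flatConst n δ)⁻¹ *
          ((∫ p, Real.cos (phase t p.1 p.2) ∂(gagliardoMeasure δ (𝓕 f : L2Rn n)))
          + 2 * ∫ η, oscCorrection n δ t η * ‖(𝓕 f : L2Rn n) η‖ ^ 2) := by
  have hk := flatConst_pos hn hδ0 hδ1
  have hg := measurable_L2 (𝓕 f : L2Rn n)
  have := isFiniteMeasure_gagliardoMeasure hn hδ0 hδ1 hf
  obtain ⟨C, hC, hE⟩ := exists_gagliardoEnergy_symbol_le hn hδ0 hδ1 hf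
  set M := gagliardoMeasure δ (𝓕 f : L2Rn n) with hM
  have hEt (t : ℝ) := ne_top_of_le_ne_top ENNReal.ofReal_ne_top (hE t)
  have hE0 := gagliardoEnergy_ne_top hn hδ0 hδ1 hf
  have hcos : Integrable (fun p : Rn n × Rn n => Real.cos (phase t p.1 p.2)) M := by
    refine Integrable.of_bound (by fun_prop) 1 (Eventually.of_forall fun p => ?_)
    exact Real.abs_cos_le_one _
  have hR : (∫⁻ p, ENNReal.ofReal (1 - Real.cos (phase t p.1 p.2)) ∂M).toReal
      = (gagliardoEnergy δ (𝓕 f : L2Rn n)).toReal - ∫ p, Real.cos (phase t p.1 p.2) ∂M := by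
    rw [← integral_eq_lintegral_of_nonneg_ae
      (Eventually.of_forall fun p => one_sub_cos_nonneg _) (by fun_prop),
      integral_sub (integrable_const _) hcos, integral_const, ← gagliardoMeasure_univ δ hg]
    simp [Measure.real, hM]
  have hRt : ∫⁻ p, ENNReal.ofReal (1 - Real.cos (phase t p.1 p.2)) ∂M ≠ ⊤ := by
    have hi : Integrable (fun p : Rn n × Rn n => 1 - Real.cos (phase t p.1 p.2)) M :=
      (integrable_const _).sub hcos
    exact hi.lintegral_lt_top.ne
  have hQi : Integrable (fun η => (flatConst n δ * |t| ^ (2 * δ) * ‖η‖ ^ (2 * δ)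
      + oscCorrection n δ t η) * ‖(𝓕 f : L2Rn n) η‖ ^ 2) := by
    have h1 := (integrable_weight_mul ((memLp_powWeight_iff δ _).1 hf.2)).const_mul
      (flatConst n δ * |t| ^ (2 * δ))
    refine (h1.add (integrable_oscCorrection_mul hn hδ0 hδ1 t (𝓕 f : L2Rn n))).congr
      (Eventually.of_forall fun η => ?_)
    simp only [Pi.add_apply]
    ring
  have hQ0 : phaseEnergy δ t (𝓕 f : L2Rn n) = ∫⁻ η, ENNReal.ofReal ((flatConst n δ * |t| ^ (2 * δ)
      * ‖η‖ ^ (2 * δ) + oscCorrection n δ t η) * ‖(𝓕 f : L2Rn n) η‖ ^ 2) := by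
    rw [phaseEnergy_eq hn hδ0 hδ1 t hg]
    refine lintegral_congr fun η => ?_
    rw [enorm_sq_eq_ofReal, ENNReal.ofReal_mul (oscCorrection_add_nonneg hn hδ0 hδ1 t η)]
  have hQ : (phaseEnergy δ t (𝓕 f : L2Rn n)).toReal
      = flatConst n δ * |t| ^ (2 * δ) * weightedNorm δ (𝓕 f : L2Rn n) ^ 2
        + ∫ η, oscCorrection n δ t η * ‖(𝓕 f : L2Rn n) η‖ ^ 2 := by
    rw [hQ0, ← integral_eq_lintegral_of_nonneg_ae (Eventually.of_forall fun η =>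
      mul_nonneg (oscCorrection_add_nonneg hn hδ0 hδ1 t η) (by positivity)) hQi.aestronglyMeasurable]
    have h1 := integrable_weight_mul ((memLp_powWeight_iff δ _).1 hf.2)
    rw [← integral_weight_mul, ← integral_const_mul, ← integral_add (h1.const_mul _)
      (integrable_oscCorrection_mul hn hδ0 hδ1 t (𝓕 f : L2Rn n))]
    congr 1
    ext η
    ring
  have hQt : phaseEnergy δ t (𝓕 f : L2Rn n) ≠ ⊤ := by
    rw [hQ0]; exact hQi.lintegral_lt_top.ne
  -- All terms are finite, so the identity passes to ℝ. There ∫ (1 - cos θ) dM is the total energy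
  -- minus ∫ cos θ dM, and the total energy cancels.
  have hmain := congrArg ENNReal.toReal (gagliardoEnergy_even δ t hg)
  rw [← hM, ENNReal.toReal_add (ENNReal.add_ne_top.2 ⟨hEt t, hEt (-t)⟩)
    (ENNReal.mul_ne_top ENNReal.ofNat_ne_top hRt), ENNReal.toReal_add (hEt t) (hEt (-t)),
    ENNReal.toReal_add (ENNReal.mul_ne_top ENNReal.ofNat_ne_top hE0)
      (ENNReal.mul_ne_top ENNReal.ofNat_ne_top hQt), ENNReal.toReal_mul, ENNReal.toReal_mul,
    ENNReal.toReal_mul, hR, hQ, ← dispersion_eq hn hδ0 hδ1, ← dispersion_eq hn hδ0 hδ1] at hmain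
  simp only [ENNReal.toReal_ofNat] at hmain
  field_simp
  linear_combination hmain / 2

end Dispersion

/-! ### Functions of quadratic growth as tempered distributions -/

theorem exists_temperedDistribution_of_growth {h : ℝ → ℝ} (hm : Measurable h) (h0 : ∀ t, 0 ≤ h t)
    {C : ℝ} (hC : ∀ t, h t ≤ C * (1 + |t|) ^ 2) : ∃ H : 𝓢'(ℝ, ℂ), IsGivenBy H h := by
  set μ : Measure ℝ := volume.withDensity fun t => ENNReal.ofReal (h t) with hμ
  have hmo : Measurable fun t => ENNReal.ofReal (h t) := hm.ennreal_ofReal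
  have hlt : ∀ᵐ t : ℝ, ENNReal.ofReal (h t) < ⊤ := Eventually.of_forall fun t => ENNReal.ofReal_lt_top
  have hgrowth : μ.HasTemperateGrowth := by
    -- Two powers absorb the growth of h and the other two give integrability on ℝ.
    refine ⟨⟨4, ?_⟩⟩
    rw [hμ, integrable_withDensity_iff_integrable_smul' hmo hlt]
    have hi : Integrable (fun t : ℝ => C * (1 + ‖t‖) ^ (-(2 : ℝ))) :=
      (integrable_one_add_norm (by simp)).const_mul C
    refine hi.mono' (by fun_prop) (Eventually.of_forall fun t => ?_)
    have h1 : 0 < 1 + ‖t‖ := by positivity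
    rw [smul_eq_mul, norm_mul, ENNReal.toReal_ofReal (h0 t), Real.norm_of_nonneg (h0 t),
      Real.norm_of_nonneg (by positivity)]
    calc _ ≤ C * (1 + |t|) ^ 2 * (1 + ‖t‖) ^ (-((4 : ℕ) : ℝ)) := by gcongr; exact hC t
      _ = _ := by
        rw [mul_assoc, Real.norm_eq_abs] at *
        rw [← Real.rpow_natCast, ← Real.rpow_add h1]
        norm_num
  refine ⟨μ.toTemperedDistribution, fun φ => ?_⟩
  have hsmul (t : ℝ) : (ENNReal.ofReal (h t)).toReal • φ t = (h t : ℂ) * φ t := by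
    rw [ENNReal.toReal_ofReal (h0 t), Complex.real_smul]
  constructor
  · have := φ.integrable (μ := μ)
    rw [hμ, integrable_withDensity_iff_integrable_smul' hmo hlt] at this
    simpa only [hsmul] using this
  · change ∫ t, φ t ∂μ = _
    rw [hμ, integral_withDensity_eq_integral_toReal_smul hmo hlt]
    simp only [hsmul]

/-! ### Fourier transform of the even cutoff -/

section Cutoff

variable {ζ : ℝ → ℝ} {hs : ContDiff ℝ ∞ ζ} {hc : HasCompactSupport ζ}

theorem dilate_one_apply (t : ℝ) : dilate ζ hs hc 1 t = (ζ t : ℂ) := by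
  rw [dilate_apply ζ hs hc one_pos, div_one]

theorem fourier_dilate {ε : ℝ} (hε : 0 < ε) (t : ℝ) :
    (𝓕 (dilate ζ hs hc ε) : 𝓢(ℝ, ℂ)) t = (ε : ℂ) * (𝓕 (dilate ζ hs hc 1) : 𝓢(ℝ, ℂ)) (ε * t) := by
  rw [SchwartzMap.fourier_coe, SchwartzMap.fourier_coe, Real.fourier_eq', Real.fourier_eq']
  have h := Measure.integral_comp_mul_left
    (fun v : ℝ => Complex.exp (((-2 * Real.pi * inner ℝ v t : ℝ) : ℂ) * Complex.I)
      • dilate ζ hs hc ε v) ε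
  rw [abs_of_pos (inv_pos.2 hε), Complex.real_smul] at h
  rw [eq_comm, ← eq_inv_mul_iff_mul_eq₀ (by exact_mod_cast hε.ne'), ← Complex.ofReal_inv, ← h]
  congr 1
  ext v
  rw [dilate_one_apply, dilate_apply ζ hs hc hε, mul_div_cancel_left₀ _ hε.ne']
  congr 4
  simp
  ring

theorem fourier_dilate_neg (heven : ∀ t, ζ (-t) = ζ t) (t : ℝ) :
    (𝓕 (dilate ζ hs hc 1) : 𝓢(ℝ, ℂ)) (-t) = (𝓕 (dilate ζ hs hc 1) : 𝓢(ℝ, ℂ)) t := by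
  rw [SchwartzMap.fourier_coe, Real.fourier_eq', Real.fourier_eq', ← integral_neg_eq_self]
  congr 1
  ext v
  rw [dilate_one_apply, dilate_one_apply, heven]
  simp

/-- The cosine integral is the mean of Fourier inversion at y and at -y, where ζ takes the same
value. -/
theorem integral_fourier_dilate_mul_cos (heven : ∀ t, ζ (-t) = ζ t) (y : ℝ) :
    ∫ τ, (𝓕 (dilate ζ hs hc 1) : 𝓢(ℝ, ℂ)) τ * (Real.cos (2 * Real.pi * τ * y) : ℂ) = (ζ y : ℂ) := by
  set Z : 𝓢(ℝ, ℂ) := 𝓕 (dilate ζ hs hc 1) with hZ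
  have hinv (y : ℝ) : ∫ τ : ℝ, Complex.exp (((2 * Real.pi * (τ * y) : ℝ) : ℂ) * Complex.I) * Z τ
      = ζ y := by
    have h : (𝓕⁻ Z : 𝓢(ℝ, ℂ)) y = ζ y := by
      rw [hZ, FourierTransform.fourierInv_fourier_eq, dilate_one_apply]
    rw [← h, SchwartzMap.fourierInv_coe, Real.fourierInv_eq']
    congr 1
    ext τ
    simp [mul_comm τ y]
  have hi (y : ℝ) : Integrable
      (fun τ : ℝ => Complex.exp (((2 * Real.pi * (τ * y) : ℝ) : ℂ) * Complex.I) * Z τ) := by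
    refine Z.integrable.norm.mono' ?_ (Eventually.of_forall fun τ => ?_)
    · exact (Continuous.mul (by fun_prop) Z.continuous).aestronglyMeasurable
    · rw [norm_mul, Complex.norm_exp_ofReal_mul_I, one_mul]
  have hcos (τ : ℝ) : Z τ * (Real.cos (2 * Real.pi * τ * y) : ℂ)
      = (1 / 2) * (Complex.exp (((2 * Real.pi * (τ * y) : ℝ) : ℂ) * Complex.I) * Z τ)
        + (1 / 2) * (Complex.exp (((2 * Real.pi * (τ * (-y)) : ℝ) : ℂ) * Complex.I) * Z τ) := by
    rw [Complex.ofReal_cos, Complex.cos]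
    push_cast
    ring_nf
  simp_rw [hcos]
  rw [integral_add ((hi y).const_mul _) ((hi (-y)).const_mul _), integral_const_mul,
    integral_const_mul, hinv, hinv, heven]
  ring

theorem conj_fourier_dilate (heven : ∀ t, ζ (-t) = ζ t) (τ : ℝ) :
    (((𝓕 (dilate ζ hs hc 1) : 𝓢(ℝ, ℂ)) τ).re : ℂ) = (𝓕 (dilate ζ hs hc 1) : 𝓢(ℝ, ℂ)) τ := by
  refine Complex.conj_eq_iff_re.1 ?_
  conv_rhs => rw [← fourier_dilate_neg heven]
  rw [SchwartzMap.fourier_coe, Real.fourier_eq', Real.fourier_eq', ← integral_conj]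
  congr 1
  ext v
  rw [smul_eq_mul, smul_eq_mul, dilate_one_apply, map_mul, Complex.conj_ofReal, ← Complex.exp_conj]
  simp [Complex.conj_ofNat]

end Cutoff

/-- An even Z sees only the even part of h, and t = τ/ε absorbs the factor ε. -/
theorem integral_comp_div_eq_even (h : ℝ → ℝ) (Z : ℝ → ℂ) (hZ : ∀ t, Z (-t) = Z t) {ε : ℝ}
    (hε : 0 < ε) (hi : Integrable fun t => (h t : ℂ) * (ε * Z (ε * t))) :
    ∫ t, (h t : ℂ) * (ε * Z (ε * t))
      = ∫ τ, (((h (τ / ε) + h (-(τ / ε))) / 2 : ℝ) : ℂ) * Z τ := by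
  have hε' : (ε : ℂ) ≠ 0 := by exact_mod_cast hε.ne'
  have hneg : Integrable fun t => (h (-t) : ℂ) * (ε * Z (ε * t)) := by
    have := hi.comp_neg
    simpa only [mul_neg, hZ] using this
  have h1 : ∫ t, (h t : ℂ) * (ε * Z (ε * t)) = ∫ t, (h (-t) : ℂ) * (ε * Z (ε * t)) := by
    rw [← integral_neg_eq_self]
    simp only [mul_neg, hZ]
  have h2 : ∫ t, (h t : ℂ) * (ε * Z (ε * t))
      = ∫ t, ε * ((((h t + h (-t)) / 2 : ℝ) : ℂ) * Z (ε * t)) := by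
    have h3 : ∫ t, (h t : ℂ) * (ε * Z (ε * t)) = (1 / 2) * ((∫ t, (h t : ℂ) * (ε * Z (ε * t)))
        + ∫ t, (h (-t) : ℂ) * (ε * Z (ε * t))) := by rw [← h1]; ring
    rw [h3, ← integral_add hi hneg, ← integral_const_mul]
    congr 1
    ext t
    push_cast
    ring
  have h4 := Measure.integral_comp_mul_left
    (fun τ : ℝ => (((h (τ / ε) + h (-(τ / ε))) / 2 : ℝ) : ℂ) * Z τ) ε
  rw [abs_of_pos (inv_pos.2 hε), Complex.real_smul] at h4
  rw [h2, integral_const_mul]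
  simp only [mul_div_cancel_left₀ _ hε.ne'] at h4
  rw [h4, Complex.ofReal_inv, mul_inv_cancel_left₀ hε']

/-- For fixed η the zero set in z is the sphere of centre -η and radius |η|, which is Lebesgue null.
-/
theorem prod_norm_add_eq_null {n : ℕ} (hn : 2 ≤ n) :
    ∀ᵐ p : Rn n × Rn n ∂(volume.prod volume), ‖p.2 + p.1‖ ^ 2 - ‖p.2‖ ^ 2 ≠ 0 := by
  have hnt : Nontrivial (Rn n) := by
    apply Module.nontrivial_of_finrank_pos (R := ℝ)
    rw [finrank_euclideanSpace_fin]; omega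
  rw [ae_iff]
  have hm : MeasurableSet {p : Rn n × Rn n | ¬ ‖p.2 + p.1‖ ^ 2 - ‖p.2‖ ^ 2 ≠ 0} := by
    simp only [not_not]
    exact measurableSet_eq_fun (by fun_prop) (by fun_prop)
  rw [Measure.prod_apply_symm hm, lintegral_eq_zero_iff' (by
    exact (measurable_measure_prodMk_right hm).aemeasurable)]
  refine Eventually.of_forall fun η => ?_
  refine measure_mono_null ?_ (Measure.addHaar_sphere volume (-η) ‖η‖)
  intro z hz
  simp only [ne_eq, not_not, Set.preimage_ofPred_eq, Set.mem_ofPred_eq] at hz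
  rw [mem_sphere_iff_norm, sub_neg_eq_add, add_comm]
  have h1 : ‖η + z‖ ^ 2 = ‖η‖ ^ 2 := by linarith
  exact (pow_left_inj₀ (norm_nonneg _) (norm_nonneg _) two_ne_zero).1 h1

/-! ### Vanishing of the two remainder terms -/

section Limits

variable {n : ℕ} {δ : ℝ} {f : L2Rn n} {ζ : ℝ → ℝ} {hs : ContDiff ℝ ∞ ζ} {hc : HasCompactSupport ζ}

/-- The phase at time τ/ε is 2πτy with y = (|η+z|² - |η|²)/(2ε), so Fubini and Fourier inversion put
y into ζ. -/
theorem integral_fourier_dilate_mul_integral_cos (hn : 2 ≤ n) (hδ0 : 0 < δ) (hδ1 : δ < 1)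
    (hf : MemSigma δ f) (heven : ∀ t, ζ (-t) = ζ t) {ε : ℝ} (hε : 0 < ε) :
    Integrable (fun τ : ℝ =>
      ((∫ p, Real.cos (phase (τ / ε) p.1 p.2) ∂(gagliardoMeasure δ (𝓕 f : L2Rn n)) : ℝ) : ℂ)
        * (𝓕 (dilate ζ hs hc 1) : 𝓢(ℝ, ℂ)) τ) ∧
    ∫ τ, ((∫ p, Real.cos (phase (τ / ε) p.1 p.2) ∂(gagliardoMeasure δ (𝓕 f : L2Rn n)) : ℝ) : ℂ)
        * (𝓕 (dilate ζ hs hc 1) : 𝓢(ℝ, ℂ)) τ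
      = ∫ p, (ζ ((‖p.2 + p.1‖ ^ 2 - ‖p.2‖ ^ 2) / (2 * ε)) : ℂ)
          ∂(gagliardoMeasure δ (𝓕 f : L2Rn n)) := by
  have := isFiniteMeasure_gagliardoMeasure hn hδ0 hδ1 hf
  set M := gagliardoMeasure δ (𝓕 f : L2Rn n)
  set Z : 𝓢(ℝ, ℂ) := 𝓕 (dilate ζ hs hc 1) with hZ
  have hZi : Integrable (fun q : ℝ × (Rn n × Rn n) =>
      ((Real.cos (phase (q.1 / ε) q.2.1 q.2.2) : ℝ) : ℂ) * Z q.1) (volume.prod M) := by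
    have h1 : Integrable (fun q : ℝ × (Rn n × Rn n) => Z q.1) (volume.prod M) :=
      Z.integrable.comp_fst M
    refine h1.norm.mono' ?_ (Eventually.of_forall fun q => ?_)
    · have hZm := Z.continuous.measurable
      exact (Measurable.mul (by fun_prop) (by fun_prop)).aestronglyMeasurable
    · rw [norm_mul, Complex.norm_real]
      exact mul_le_of_le_one_left (norm_nonneg _) (Real.abs_cos_le_one _)
  have h1 (τ : ℝ) : ((∫ p, Real.cos (phase (τ / ε) p.1 p.2) ∂M : ℝ) : ℂ) * Z τ
      = ∫ p, ((Real.cos (phase (τ / ε) p.1 p.2) : ℝ) : ℂ) * Z τ ∂M := by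
    rw [integral_mul_const]
    congr 1
    exact (integral_ofReal (𝕜 := ℂ)).symm
  simp_rw [h1]
  refine ⟨hZi.integral_prod_left, ?_⟩
  rw [integral_integral_swap hZi]
  congr 1
  ext p
  rw [← integral_fourier_dilate_mul_cos (hs := hs) (hc := hc) heven]
  congr 1
  ext τ
  rw [mul_comm, ← hZ]
  congr 3
  rw [phase]
  field_simp

theorem tendsto_integral_cutoff (hn : 2 ≤ n) (hδ0 : 0 < δ) (hδ1 : δ < 1)
    (hf : MemSigma δ f) (hs : ContDiff ℝ ∞ ζ) (hc : HasCompactSupport ζ)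
    (hsupp : tsupport ζ ⊆ Set.Ioo (-1) 1) :
    Tendsto (fun ε : ℝ => ∫ p, (ζ ((‖p.2 + p.1‖ ^ 2 - ‖p.2‖ ^ 2) / (2 * ε)) : ℂ)
          ∂(gagliardoMeasure δ (𝓕 f : L2Rn n))) (𝓝[>] 0) (𝓝 0) := by
  have := isFiniteMeasure_gagliardoMeasure hn hδ0 hδ1 hf
  set M := gagliardoMeasure δ (𝓕 f : L2Rn n) with hM
  obtain ⟨K, hK⟩ := hc.exists_bound_of_continuous hs.continuous
  have hae : ∀ᵐ p ∂M, ‖p.2 + p.1‖ ^ 2 - ‖p.2‖ ^ 2 ≠ 0 :=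
    (withDensity_absolutelyContinuous _ _).ae_le (prod_norm_add_eq_null hn)
  rw [← integral_zero (Rn n × Rn n) ℂ (μ := M)]
  have hζm := hs.continuous.measurable
  refine tendsto_integral_filter_of_dominated_convergence (fun _ => K)
    (Eventually.of_forall fun ε => by fun_prop) (Eventually.of_forall fun ε =>
      Eventually.of_forall fun p => ?_) (integrable_const K) ?_
  · rw [Complex.norm_real]; exact hK _
  · filter_upwards [hae] with p hp
    refine tendsto_const_nhds.congr' ?_
    set s := ‖p.2 + p.1‖ ^ 2 - ‖p.2‖ ^ 2 with hsdef
    have hs0 : 0 < |s| / 2 := by have := abs_pos.2 hp; positivity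
    filter_upwards [Ioo_mem_nhdsGT hs0] with ε hε
    -- Once ε < |s|/2 the argument has modulus above 1, outside the support of ζ.
    have hz : ζ (s / (2 * ε)) = 0 := by
      by_contra hne
      have hmem := hsupp (subset_tsupport ζ hne)
      have h1 := abs_lt.2 hmem
      rw [abs_div, abs_of_pos (by linarith [hε.1] : 0 < 2 * ε), div_lt_one (by linarith [hε.1])] at h1
      linarith [hε.2]
    rw [hz, Complex.ofReal_zero]

/-- Dominated convergence is used twice. In η the majorant C|η|^{-2δ}|g|² is uniform in time and
integrable by Hardy; in τ the resulting uniform bound is multiplied by |Z|. -/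
theorem tendsto_integral_oscCorrection (hn : 2 ≤ n) (hδ0 : 0 < δ) (hδ1 : δ < 1)
    (hf : MemSigma δ f) (Z : 𝓢(ℝ, ℂ)) :
    (∀ ε : ℝ, Integrable (fun τ : ℝ =>
      ((∫ η, oscCorrection n δ (τ / ε) η * ‖(𝓕 f : L2Rn n) η‖ ^ 2 : ℝ) : ℂ) * Z τ)) ∧
    Tendsto (fun ε : ℝ => ∫ τ,
      ((∫ η, oscCorrection n δ (τ / ε) η * ‖(𝓕 f : L2Rn n) η‖ ^ 2 : ℝ) : ℂ) * Z τ)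
      (𝓝[>] 0) (𝓝 0) := by
  have hg := measurable_L2 (𝓕 f : L2Rn n)
  have hnt : Nontrivial (Rn n) := by
    apply Module.nontrivial_of_finrank_pos (R := ℝ)
    rw [finrank_euclideanSpace_fin]; omega
  obtain ⟨C, hC, hb⟩ := exists_abs_oscCorrection_le hn hδ0 hδ1
  have hhardy := integrable_weight_mul (lintegral_hardy_ne_top hn hδ0 hδ1 hg
    (lintegral_L2_ne_top _) (gagliardoEnergy_ne_top hn hδ0 hδ1 hf))
  set g : Rn n → ℂ := ⇑(𝓕 f : L2Rn n)
  have hcm : Measurable (fun p : ℝ × Rn n => oscCorrection n δ p.1 p.2) :=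
    (continuous_oscCorrection hn hδ0 hδ1).measurable
  have hae : ∀ᵐ η : Rn n, η ≠ 0 := by simp [ae_iff]
  have hdom (t : ℝ) (η : Rn n) (hη : η ≠ 0) : ‖oscCorrection n δ t η * ‖g η‖ ^ 2‖
      ≤ C * (‖η‖ ^ (-(2 * δ)) * ‖g η‖ ^ 2) := by
    have hη0 : 0 < ‖η‖ := norm_pos_iff.2 hη
    rw [norm_mul, Real.norm_eq_abs, Real.norm_of_nonneg (by positivity), ← mul_assoc]
    refine mul_le_mul_of_nonneg_right ?_ (by positivity)
    rw [Real.rpow_neg hη0.le, ← div_eq_mul_inv, le_div_iff₀ (by positivity)]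
    exact (hb t η).2.2
  set r : ℝ → ℝ := fun t => ∫ η, oscCorrection n δ t η * ‖g η‖ ^ 2 with hr
  set R := ∫ η, C * (‖η‖ ^ (-(2 * δ)) * ‖g η‖ ^ 2) with hR
  have hrb (t : ℝ) : ‖r t‖ ≤ R :=
    norm_integral_le_of_norm_le (hhardy.const_mul C) (hae.mono fun η hη => hdom t η hη)
  have hrm : Measurable r := by
    refine (StronglyMeasurable.integral_prod_right' (f := fun p : ℝ × Rn n =>
      oscCorrection n δ p.1 p.2 * ‖g p.2‖ ^ 2) ?_).measurable
    exact (hcm.mul (by fun_prop)).stronglyMeasurable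
  have hrlim (τ : ℝ) (hτ : τ ≠ 0) : Tendsto (fun ε : ℝ => r (τ / ε)) (𝓝[>] 0) (𝓝 0) := by
    rw [show 𝓝 (0 : ℝ) = 𝓝 (∫ _ : Rn n, (0 : ℝ)) by rw [integral_zero]]
    refine tendsto_integral_filter_of_dominated_convergence _
      (Eventually.of_forall fun ε => ?_) (Eventually.of_forall fun ε =>
        hae.mono fun η hη => hdom (τ / ε) η hη) (hhardy.const_mul C) ?_
    · exact ((hcm.comp (measurable_const.prodMk measurable_id)).mul
        (by fun_prop)).aestronglyMeasurable
    · filter_upwards [hae] with η hη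
      have hη0 : 0 < ‖η‖ := norm_pos_iff.2 hη
      rw [show 𝓝 (0 : ℝ) = 𝓝 (0 * ‖g η‖ ^ 2) by rw [zero_mul]]
      refine Tendsto.mul_const _ ?_
      -- Since δ - 1 < 0 and |τ/ε| → ∞, the decay bound forces pointwise convergence to 0 off η = 0.
      have hlim : Tendsto (fun ε : ℝ => C * |τ / ε| ^ (δ - 1) / ‖η‖ ^ 2) (𝓝[>] 0) (𝓝 0) := by
        have h1 : Tendsto (fun ε : ℝ => |τ / ε|) (𝓝[>] 0) atTop := by
          have h2 : Tendsto (fun ε : ℝ => |τ| * ε⁻¹) (𝓝[>] 0) atTop :=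
            tendsto_inv_nhdsGT_zero.const_mul_atTop (abs_pos.2 hτ)
          refine h2.congr' ?_
          filter_upwards [self_mem_nhdsWithin] with ε hε
          rw [abs_div, abs_of_pos (show 0 < ε from hε), div_eq_mul_inv]
        have h3 := (tendsto_rpow_neg_atTop (by linarith : 0 < 1 - δ)).comp h1
        have h4 := (h3.const_mul C).div_const (‖η‖ ^ 2)
        simpa [Function.comp_def] using h4
      refine squeeze_zero_norm (fun ε => ?_) hlim
      rw [Real.norm_eq_abs, le_div_iff₀ (by positivity)]
      exact (hb _ _).2.1
  have hZm := Z.continuous.measurable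
  have hbd (ε τ : ℝ) : ‖((r (τ / ε) : ℝ) : ℂ) * Z τ‖ ≤ R * ‖Z τ‖ := by
    rw [norm_mul, Complex.norm_real]
    exact mul_le_mul_of_nonneg_right (hrb _) (norm_nonneg _)
  have hmeas (ε : ℝ) : AEStronglyMeasurable (fun τ : ℝ => ((r (τ / ε) : ℝ) : ℂ) * Z τ) := by
    exact Measurable.aestronglyMeasurable (by fun_prop)
  refine ⟨fun ε => (Z.integrable.norm.const_mul R).mono' (hmeas ε)
    (Eventually.of_forall (hbd ε)), ?_⟩
  rw [← integral_zero ℝ ℂ (μ := volume)]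
  refine tendsto_integral_filter_of_dominated_convergence (fun τ => R * ‖Z τ‖)
    (Eventually.of_forall hmeas) (Eventually.of_forall fun ε => Eventually.of_forall (hbd ε))
    (Z.integrable.norm.const_mul R) ?_
  have hae0 : ∀ᵐ τ : ℝ, τ ≠ 0 := by simp [ae_iff]
  filter_upwards [hae0] with τ hτ
  have := ((Complex.continuous_ofReal.tendsto 0).comp (hrlim τ hτ)).mul_const (Z τ)
  simpa [Function.comp_def] using this

end Limits

theorem integrable_abs_rpow_mul_schwartz {s : ℝ} (hs0 : 0 ≤ s) (hs2 : s ≤ 2) (Z : 𝓢(ℝ, ℂ)) :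
    Integrable fun τ : ℝ => ((|τ| ^ s : ℝ) : ℂ) * Z τ := by
  have h1 : Integrable fun τ : ℝ => ‖Z τ‖ + ‖τ‖ ^ 2 * ‖Z τ‖ :=
    Z.integrable.norm.add (Z.integrable_pow_mul volume 2)
  have hZm := Z.continuous.measurable
  refine h1.mono' (Measurable.aestronglyMeasurable (by fun_prop)) (Eventually.of_forall fun τ => ?_)
  rw [norm_mul, Complex.norm_real, Real.norm_of_nonneg (by positivity), ← one_add_mul,
    Real.norm_eq_abs]
  refine mul_le_mul_of_nonneg_right ?_ (norm_nonneg _)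
  rcases le_total |τ| 1 with h | h
  · exact (Real.rpow_le_one (abs_nonneg _) h hs0).trans (by nlinarith [sq_nonneg |τ|])
  · refine (Real.rpow_le_rpow_of_exponent_le h hs2).trans ?_
    rw [Real.rpow_two]
    linarith

/-! ### The leading term and the o(1) remainder -/

section Asymptotics

variable {n : ℕ} {δ : ℝ} {f : L2Rn n} {ζ : ℝ → ℝ}

/-- The coefficient of the leading term: `∫ |τ|^{2δ} ζ̂(τ) dτ`. -/
def leadingConst (δ : ℝ) (ζ : ℝ → ℝ) (hs : ContDiff ℝ ∞ ζ) (hc : HasCompactSupport ζ) : ℝ :=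
  ∫ τ : ℝ, |τ| ^ (2 * δ) * ((𝓕 (dilate ζ hs hc 1) : 𝓢(ℝ, ℂ)) τ).re

theorem ofReal_leadingConst (hs : ContDiff ℝ ∞ ζ) (hc : HasCompactSupport ζ)
    (heven : ∀ t, ζ (-t) = ζ t) : (leadingConst δ ζ hs hc : ℂ)
      = ∫ τ : ℝ, ((|τ| ^ (2 * δ) : ℝ) : ℂ) * (𝓕 (dilate ζ hs hc 1) : 𝓢(ℝ, ℂ)) τ := by
  rw [leadingConst]
  refine (integral_ofReal (𝕜 := ℂ)).symm.trans ?_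
  congr 1
  ext τ
  rw [← conj_fourier_dilate heven τ]
  simp

/-- After rescaling, the power term of the even part gives the leading term exactly, for every ε >
0; what remains is the two terms already known to vanish. No distinction between ranges of δ enters.
-/
theorem tendsto_fourier_dispersion_sub (hn : 2 ≤ n) (hδ0 : 0 < δ) (hδ1 : δ < 1)
    (hf : MemSigma δ f) (hs : ContDiff ℝ ∞ ζ) (hc : HasCompactSupport ζ)
    (hsupp : tsupport ζ ⊆ Set.Ioo (-1) 1) (heven : ∀ t, ζ (-t) = ζ t)
    {H : 𝓢'(ℝ, ℂ)} (hH : IsGivenBy H (dispersion δ f)) :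
    Tendsto (fun ε : ℝ => (𝓕 H) (dilate ζ hs hc ε)
      - ((leadingConst δ ζ hs hc * ε ^ (-2 * δ) * weightedNorm δ (𝓕 f : L2Rn n) ^ 2 : ℝ) : ℂ))
      (𝓝[>] 0) (𝓝 0) := by
  set Z : 𝓢(ℝ, ℂ) := 𝓕 (dilate ζ hs hc 1) with hZ
  set w := weightedNorm δ (𝓕 f : L2Rn n) with hw
  set κ := (2 * flatConst n δ)⁻¹ with hκ
  obtain ⟨hosci, hosc⟩ := tendsto_integral_oscCorrection hn hδ0 hδ1 hf Z
  have hcut := tendsto_integral_cutoff hn hδ0 hδ1 hf hs hc hsupp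
  have hlim := (hcut.add (hosc.const_mul 2)).const_mul (κ : ℂ)
  rw [mul_zero, add_zero, mul_zero] at hlim
  refine hlim.congr' ?_
  filter_upwards [self_mem_nhdsWithin] with ε hε
  have hε : 0 < ε := hε
  obtain ⟨hcosi, hcos⟩ := integral_fourier_dilate_mul_integral_cos (hs := hs) (hc := hc)
    hn hδ0 hδ1 hf heven hε
  rw [← hZ] at hcosi hcos
  have hpow := integrable_abs_rpow_mul_schwartz (by linarith : 0 ≤ 2 * δ) (by linarith) Z
  obtain ⟨hi, hval⟩ := hH (𝓕 (dilate ζ hs hc ε) : 𝓢(ℝ, ℂ))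
  simp_rw [fourier_dilate hε] at hi hval
  have hpair : (𝓕 H) (dilate ζ hs hc ε) = H (𝓕 (dilate ζ hs hc ε) : 𝓢(ℝ, ℂ)) := rfl
  rw [hpair, hval, integral_comp_div_eq_even _ Z (fourier_dilate_neg heven) hε hi, eq_sub_iff_add_eq']
  have hsplit (τ : ℝ) : (((dispersion δ f (τ / ε) + dispersion δ f (-(τ / ε))) / 2 : ℝ) : ℂ) * Z τ
      = ((ε ^ (-2 * δ) * w ^ 2 : ℝ) : ℂ) * (((|τ| ^ (2 * δ) : ℝ) : ℂ) * Z τ)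
        + (κ : ℂ) * (((∫ p, Real.cos (phase (τ / ε) p.1 p.2)
            ∂(gagliardoMeasure δ (𝓕 f : L2Rn n)) : ℝ) : ℂ) * Z τ
          + 2 * (((∫ η, oscCorrection n δ (τ / ε) η * ‖(𝓕 f : L2Rn n) η‖ ^ 2 : ℝ) : ℂ) * Z τ)) := by
    rw [dispersion_even_part hn hδ0 hδ1 hf, abs_div, abs_of_pos hε,
      Real.div_rpow (abs_nonneg _) hε.le, neg_mul, Real.rpow_neg hε.le, ← hκ, ← hw, div_eq_mul_inv]
    push_cast
    ring
  have hsum : Integrable fun τ : ℝ => (κ : ℂ) * (((∫ p, Real.cos (phase (τ / ε) p.1 p.2)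
      ∂(gagliardoMeasure δ (𝓕 f : L2Rn n)) : ℝ) : ℂ) * Z τ
        + 2 * (((∫ η, oscCorrection n δ (τ / ε) η * ‖(𝓕 f : L2Rn n) η‖ ^ 2 : ℝ) : ℂ) * Z τ)) :=
    (hcosi.add ((hosci ε).const_mul 2)).const_mul _
  simp_rw [hsplit]
  rw [integral_add (hpow.const_mul _) hsum,
    integral_const_mul, integral_const_mul, integral_add hcosi ((hosci ε).const_mul 2),
    integral_const_mul, hcos, ← ofReal_leadingConst hs hc heven]
  push_cast
  ring

/-- As 2δ > 1, |ξ|^{-1} is at most |ξ|^{-2δ} on the unit ball and at most 1 outside, so Hardy and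
the L² norm control it. -/
theorem memLp_powWeight_neg_half (hn : 2 ≤ n) (hδ : 1 / 2 < δ) (hδ1 : δ < 1) (hf : MemSigma δ f) :
    MemLp (powWeight (-1 / 2) (𝓕 f : L2Rn n)) 2 volume := by
  have hg := measurable_L2 (𝓕 f : L2Rn n)
  have hδ0 : 0 < δ := by linarith
  have h2 := lintegral_L2_ne_top (𝓕 f : L2Rn n)
  have hhardy := lintegral_hardy_ne_top hn hδ0 hδ1 hg h2 (gagliardoEnergy_ne_top hn hδ0 hδ1 hf)
  rw [memLp_powWeight_iff]
  refine ne_top_of_le_ne_top (ENNReal.add_ne_top.2 ⟨h2, hhardy⟩) ?_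
  rw [← lintegral_add_left (by fun_prop)]
  refine lintegral_mono fun ξ => ?_
  rw [← one_add_mul]
  gcongr
  rw [← ENNReal.ofReal_one, ← ENNReal.ofReal_add one_pos.le (by positivity)]
  refine ENNReal.ofReal_le_ofReal ?_
  have hpos : 0 ≤ ‖ξ‖ ^ (-(2 * δ)) := by positivity
  rcases (norm_nonneg ξ).eq_or_lt with h0 | h0
  · rw [← h0, Real.zero_rpow (by norm_num)]
    positivity
  rcases le_total ‖ξ‖ 1 with h | h
  · have := Real.rpow_le_rpow_of_exponent_ge h0 h (by linarith : -(2 * δ) ≤ 2 * (-1 / 2))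
    linarith
  · have := Real.rpow_le_one_of_one_le_of_nonpos h (by norm_num : (2 : ℝ) * (-1 / 2) ≤ 0)
    linarith

end Asymptotics

theorem one_isBigO_neg_log : (fun _ : ℝ => (1 : ℝ)) =O[𝓝[>] 0] fun ε : ℝ => -Real.log ε := by
  have h : Tendsto (fun ε : ℝ => -Real.log ε) (𝓝[>] 0) atTop :=
    tendsto_neg_atBot_atTop.comp Real.tendsto_log_nhdsGT_zero
  refine IsBigO.of_bound 1 ?_
  filter_upwards [h.eventually_ge_atTop 1] with ε hε
  rw [one_mul, norm_one]
  exact hε.trans (le_abs_self _)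

end

/-- The constants are `A = ∫ |τ|^{2δ} ζ̂(τ) dτ` and `B = 0`. The even part of `h_δ` is
`|t|^{2δ} ‖|ξ|^δ f̂‖²` plus the cosine transform of a finite measure without an atom at `0` plus a
function tending to `0` at infinity, so the remainder after the leading term is `o(1)` in all
three ranges of `δ`; for `1/2 < δ`, where `ε^{1/2-δ} → ∞`, this leaves no other choice of `B`. -/
theorem mainTheorem10 (n : ℕ) (hn : 2 ≤ n) (δ : ℝ) (hδ0 : 0 < δ) (hδ1 : δ < 1)
    (ζ : ℝ → ℝ) (hsmooth : ContDiff ℝ ∞ ζ) (hcpt : HasCompactSupport ζ)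
    (hsupp : tsupport ζ ⊆ Set.Ioo (-1) 1) (heven : ∀ t, ζ (-t) = ζ t) (hnonneg : ∀ t, 0 ≤ ζ t)
    (hone : ∀ᶠ t in 𝓝 (0 : ℝ), ζ t = 1) :
    ∃ A B : ℝ, ∀ f : L2Rn n, MemSigma δ f →
      (∀ t : ℝ, Integrable (dispersionDensity δ f t) volume) ∧
      ∃ H : 𝓢'(ℝ, ℂ), IsGivenBy H (dispersion δ f) ∧
        (δ < 1 / 2 →
          (fun ε : ℝ => (𝓕 H) (dilate ζ hsmooth hcpt ε)
              - ((A * ε ^ (-2 * δ) * weightedNorm δ (𝓕 f : L2Rn n) ^ 2 : ℝ) : ℂ))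
            =o[𝓝[>] 0] (fun _ => (1 : ℝ))) ∧
        (δ = 1 / 2 →
          (fun ε : ℝ => (𝓕 H) (dilate ζ hsmooth hcpt ε)
              - ((A * ε⁻¹ * weightedNorm (1 / 2) (𝓕 f : L2Rn n) ^ 2
                + B * ∫ ξ in {ξ : Rn n | Real.sqrt (2 * ε) < ‖ξ‖},
                    ‖(𝓕 f : L2Rn n) ξ‖ ^ 2 / ‖ξ‖ : ℝ) : ℂ))
            =o[𝓝[>] 0] (fun _ => (1 : ℝ)) ∧
          (fun ε : ℝ => (𝓕 H) (dilate ζ hsmooth hcpt ε)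
              - ((A * ε⁻¹ * weightedNorm (1 / 2) (𝓕 f : L2Rn n) ^ 2 : ℝ) : ℂ))
            =O[𝓝[>] 0] (fun ε : ℝ => -Real.log ε)) ∧
        (1 / 2 < δ →
          MemLp (powWeight (-1 / 2) (𝓕 f : L2Rn n)) 2 volume ∧
          (fun ε : ℝ => (𝓕 H) (dilate ζ hsmooth hcpt ε)
              - ((A * ε ^ (-2 * δ) * weightedNorm δ (𝓕 f : L2Rn n) ^ 2
                + B * ε ^ (1 / 2 - δ) * weightedNorm (-1 / 2) (𝓕 f : L2Rn n) ^ 2 : ℝ) : ℂ))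
            =o[𝓝[>] 0] (fun _ => (1 : ℝ))) := by
  refine ⟨leadingConst δ ζ hsmooth hcpt, 0, fun f hf => ⟨integrable_dispersionDensity hn hδ0 hδ1 hf,
    ?_⟩⟩
  obtain ⟨C, -, hC⟩ := exists_dispersion_le hn hδ0 hδ1 hf
  obtain ⟨H, hH⟩ := exists_temperedDistribution_of_growth (measurable_dispersion hn hδ0 hδ1 f)
    (dispersion_nonneg δ f) hC
  have hlim := (isLittleO_one_iff ℝ).2
    (tendsto_fourier_dispersion_sub hn hδ0 hδ1 hf hsmooth hcpt hsupp heven hH)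
  refine ⟨H, hH, fun _ => hlim, fun hδ => ?_, fun hδ =>
    ⟨memLp_powWeight_neg_half hn hδ hδ1 hf, ?_⟩⟩
  · subst hδ
    have hexp (ε : ℝ) : ε ^ (-2 * (1 / 2) : ℝ) = ε⁻¹ := by
      rw [show (-2 * (1 / 2) : ℝ) = -1 by norm_num, Real.rpow_neg_one]
    simp only [hexp] at hlim
    refine ⟨?_, hlim.isBigO.trans one_isBigO_neg_log⟩
    simpa only [zero_mul, add_zero] using hlim
  · simpa only [zero_mul, add_zero] using hlim
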